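/- Let $d\ge 1$, $n\ge 2$, $\lambda,C_0,\Lambda_0>0$. There are constants $c_2,\dots,c_n>0$ and $c>0$ depending only on $(d,n,\lambda,C_0,\Lambda_0)$, and for every $K\ge 1$ a constant $C>0$ depending only on $(d,n,\lambda,C_0,\Lambda_0,K)$, such that the following holds. Let $N\ge0$, $L_0\in\mathbb R$, and let $A=A(x,y_1,\dots,y_n)$, $x\in\mathbb R^N$, $y_k\in\mathbb R^d$, be a real $d\times d$ matrix function, $1$-periodic in each $y_k$, with $\xi\cdot A\xi\ge\lambda|\xi|^2$ and $|A\xi|\le\lambda^{-1}|\xi|$ for all $\xi\in\mathbb R^d$, such that $A$ is smooth in $y=(y_1,\dots,y_n)$ and differentiable in $x$, $\nabla_xA$ is smooth in $y$, and with $\mathbf D_n=(\nabla_{y_1},\dots,\nabla_{y_n})$, for all $\ell\ge0$, $$\sup_{x,y}|\mathbf D_n^\ell A|\le C_0\Lambda_0^\ell\,\ell!,\qquad \sup_{x,y}|\mathbf D_n^\ell\nabla_xA|\le L_0\Lambda_0^\ell\,\ell!,$$ where $|T|$ is the sum of the absolute values of the entries of a tensor $T$. Let $1\ge\varepsilon_1>\dots>\varepsilon_n>0$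 satisfy $$\varepsilon_j\le\frac{c_j\,\varepsilon_{j-1}}{1+\log(\varepsilon_1/\varepsilon_{j-1})},\qquad 2\le j\le n,$$ let $\tau>0$ satisfy $K^{-1}M\le\tau^2\le KM$ with $M=\max_{2\le j\le n}e^{-c\,\varepsilon_{j-1}/\varepsilon_j}$, and put $\delta_k=\varepsilon_k/\varepsilon_1$, $\widehat\nabla_n=\sum_{k=1}^n\delta_k^{-1}\nabla_{y_k}$, $\widehat\Delta_n=\widehat\nabla_n\cdot\widehat\nabla_n$. Then for every $x\in\mathbb R^N$ and $1\le j\le d$ there is a unique smooth $\mathcal X^j(x,\cdot)$, $1$-periodic in each $y_k$, with $$-\widehat\nabla_n\cdot A(x,\cdot)\widehat\nabla_n\mathcal X^j+\tau^2\mathcal X^j=\widehat\nabla_n\cdot(A(x,\cdot)e_j),$$ and, with $\overline A(x)=\int_{[0,1]^{d\times n}}\big(A+A\widehat\nabla_n\mathcal X\big)(x,y)\,dy$, where $(A\widehat\nabla_n\mathcal X)_{ij}=\sum_kA_{ik}(\widehat\nabla_n)_k\mathcal X^j$, there is a unique smooth matrix function $\mathcal U(x,\cdot)$, $1$-periodic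 in each $y_k$, with $$-\widehat\Delta_n\,\mathcal U+\tau^2\,\mathcal U=\overline A(x)-A(x,\cdot)-A(x,\cdot)\widehat\nabla_n\mathcal X(x,\cdot).$$ Let $\Phi_{\ell ij}=(\widehat\nabla_n)_\ell\,\mathcal U_{ij}-(\widehat\nabla_n)_i\,\mathcal U_{\ell j}$, and for $y\in\mathbb R^d$ let $B_\delta(x,y)=A(x,y/\delta_1,\dots,y/\delta_n)$, and define $\mathcal X_\delta$, $\Phi_\delta$ from $\mathcal X$, $\Phi$ in the same way. Then $\Phi_{\ell ij}=-\Phi_{i\ell j}$ and $$\sup_{x\in\mathbb R^N}\big\|B_\delta(x,\cdot)+B_\delta(x,\cdot)\nabla_y\mathcal X_\delta(x,\cdot)-\overline A(x)-\nabla_y\cdot\Phi_\delta(x,\cdot)\big\|_{L^\infty(\mathbb R^d)}\le C\tau,$$ where $(\nabla_y\cdot\Phi_\delta)_{ij}=\sum_\ell\partial_{y^\ell}\Phi_{\delta,\ell ij}$ and the norm of a matrix function is the sum of the $L^\infty$ norms of its entries. In particular $C$ does not depend on $L_0$, $N$, $\varepsilon$ or $\tau$. -/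

import Mathlib

open MeasureTheory
open scoped ENNReal ContDiff Matrix Nat

noncomputable section

namespace Multiscale

/-- The space `ℝ^{d×n}` of the variables `(y_1, …, y_n)`, `y_k ∈ ℝ^d`; `y k i` is the `i`-th
component of `y_k`. Functions on the torus are functions on this space that are `1`-periodic. -/
abbrev Vars (d n : ℕ) : Type := Fin n → Fin d → ℝ

/-- The coordinate direction of `y_k^i` in `ℝ^{d×n}`. -/
def dir {d n : ℕ} (k : Fin n) (i : Fin d) : Vars d n := Pi.single k (Pi.single i 1)

/-- `1`-periodicity in each of `y_1, …, y_n`. -/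
def IsCellPeriodic {d n : ℕ} {β : Type*} (f : Vars d n → β) : Prop :=
  ∀ (y : Vars d n) (z : Fin n → Fin d → ℤ), f (fun k i => y k i + (z k i : ℝ)) = f y

/-- `|D_n^ℓ f|(y)` for a scalar function `f`, where `D_n = (∇_1, …, ∇_n)`: the sum of the absolute
values of all the entries of the tensor of derivatives of order `ℓ`. -/
def absDeriv {d n : ℕ} (ℓ : ℕ) (f : Vars d n → ℝ) (y : Vars d n) : ℝ :=
  ∑ J : Fin ℓ → Fin n × Fin d,
    |iteratedFDeriv ℝ ℓ f y (fun s => dir (J s).1 (J s).2)|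

/-- The `i`-th component of `∇̂_n = ∑_k δ_k⁻¹ ∇_{y_k}`, acting on a scalar function. -/
def hatD {d n : ℕ} (δ : Fin n → ℝ) (i : Fin d) (f : Vars d n → ℝ) (y : Vars d n) : ℝ :=
  ∑ k, (δ k)⁻¹ * fderiv ℝ f y (dir k i)

/-- The divergence `∇̂_n · F` of a vector field `F` on `ℝ^{d×n}` with values in `ℝ^d`. -/
def hatDiv {d n : ℕ} (δ : Fin n → ℝ) (F : Vars d n → Fin d → ℝ) (y : Vars d n) : ℝ :=
  ∑ i, hatD δ i (fun y' => F y' i) y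

/-- The gradient `∇̂_n f`. -/
def hatGrad {d n : ℕ} (δ : Fin n → ℝ) (f : Vars d n → ℝ) (y : Vars d n) : Fin d → ℝ :=
  fun i => hatD δ i f y

/-- The average `⟨f⟩` over the periodicity cell `[0,1]^{d×n}`. -/
def cellAverage {d n : ℕ} (f : Vars d n → ℝ) : ℝ :=
  ∫ y in Set.Icc (0 : Vars d n) 1, f y

/-- The coefficients `A(x, y_1, …, y_n)` with a parameter `x ∈ ℝ^N`: uniform ellipticity and
boundedness with constant `lam`, periodicity in each `y_k`, and the bounds
`|D_n^ℓ A| ≤ C₀ Λ₀^ℓ ℓ!` and `|D_n^ℓ ∇_x A| ≤ L₀ Λ₀^ℓ ℓ!`, uniformly in `x`. -/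
structure IsCoefficient {N d n : ℕ} (lam C₀ Λ₀ L₀ : ℝ)
    (A : (Fin N → ℝ) → Vars d n → Matrix (Fin d) (Fin d) ℝ) : Prop where
  elliptic : ∀ x y (ξ : Fin d → ℝ), lam * (ξ ⬝ᵥ ξ) ≤ ξ ⬝ᵥ (A x y *ᵥ ξ)
  bounded : ∀ x y (ξ : Fin d → ℝ),
    √((A x y *ᵥ ξ) ⬝ᵥ (A x y *ᵥ ξ)) ≤ lam⁻¹ * √(ξ ⬝ᵥ ξ)
  periodic : ∀ x, IsCellPeriodic (A x)
  smooth : ∀ x i j, ContDiff ℝ ∞ (fun y => A x y i j)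
  analytic : ∀ x y (ℓ : ℕ),
    ∑ i, ∑ j, absDeriv ℓ (fun y' => A x y' i j) y ≤ C₀ * Λ₀ ^ ℓ * (ℓ ! : ℝ)
  differentiable_param : ∀ y i j, Differentiable ℝ (fun x => A x y i j)
  smooth_param : ∀ x i j (m : Fin N),
    ContDiff ℝ ∞ (fun y => fderiv ℝ (fun x' => A x' y i j) x (Pi.single m 1))
  analytic_param : ∀ x y (ℓ : ℕ),
    ∑ i, ∑ j, ∑ m : Fin N,
      absDeriv ℓ (fun y' => fderiv ℝ (fun x' => A x' y' i j) x (Pi.single m 1)) y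
        ≤ L₀ * Λ₀ ^ ℓ * (ℓ ! : ℝ)

/-- `X` is the (smooth, periodic) solution of
`-∇̂_n · A ∇̂_n X + τ² X = ∇̂_n · (A v)` on the torus. (Integrating the equation shows that
`⟨X⟩ = 0`.) -/
structure IsCorrector {d n : ℕ} (δ : Fin n → ℝ) (τ : ℝ)
    (A : Vars d n → Matrix (Fin d) (Fin d) ℝ) (v : Fin d → ℝ) (X : Vars d n → ℝ) : Prop where
  smooth : ContDiff ℝ ∞ X
  periodic : IsCellPeriodic X
  equation : ∀ y, -hatDiv δ (fun y' => A y' *ᵥ hatGrad δ X y') y + τ ^ 2 * X y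
    = hatDiv δ (fun y' => A y' *ᵥ v) y

/-- The matrix `A + A ∇̂_n 𝒳`, with entries `A_{ij} + A_{ik} (∇̂_n)_k 𝒳^j`. -/
def flux {d n : ℕ} (δ : Fin n → ℝ) (A : Vars d n → Matrix (Fin d) (Fin d) ℝ)
    (X : Fin d → Vars d n → ℝ) (y : Vars d n) : Matrix (Fin d) (Fin d) ℝ :=
  fun i j => A y i j + ∑ k, A y i k * hatD δ k (X j) y

/-- The effective matrix `Ā = ⟨A + A ∇̂_n 𝒳⟩`. -/
def effective {d n : ℕ} (δ : Fin n → ℝ) (A : Vars d n → Matrix (Fin d) (Fin d) ℝ)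
    (X : Fin d → Vars d n → ℝ) : Matrix (Fin d) (Fin d) ℝ :=
  fun i j => cellAverage (fun y => flux δ A X y i j)

/-- `U` is the (smooth, periodic) solution of the `(i, j)` component of
`-Δ̂_n 𝒰 + τ² 𝒰 = Ā - A - A ∇̂_n 𝒳` on the torus, where `Δ̂_n = ∇̂_n · ∇̂_n`. -/
structure IsFluxPotential {d n : ℕ} (δ : Fin n → ℝ) (τ : ℝ)
    (A : Vars d n → Matrix (Fin d) (Fin d) ℝ) (X : Fin d → Vars d n → ℝ) (i j : Fin d)
    (U : Vars d n → ℝ) : Prop where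
  smooth : ContDiff ℝ ∞ U
  periodic : IsCellPeriodic U
  equation : ∀ y, -hatDiv δ (hatGrad δ U) y + τ ^ 2 * U y
    = effective δ A X i j - flux δ A X y i j

/-- The flux corrector `Φ_{ℓij} = (∇̂_n)_ℓ 𝒰_{ij} - (∇̂_n)_i 𝒰_{ℓj}`. -/
def fluxCorrector {d n : ℕ} (δ : Fin n → ℝ) (U : Fin d → Fin d → Vars d n → ℝ)
    (l i j : Fin d) (y : Vars d n) : ℝ :=
  hatD δ l (U i j) y - hatD δ i (U l j) y

/-- `f_δ(y) = f(y/δ_1, …, y/δ_n)` for `y ∈ ℝ^d`. -/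
def atScales {d n : ℕ} {β : Type*} (δ : Fin n → ℝ) (f : Vars d n → β) (y : Fin d → ℝ) : β :=
  f (fun k i => y i / δ k)

/-- The partial derivative `∂_{y^i} f` of a scalar function on `ℝ^d`. -/
def pd {d : ℕ} (i : Fin d) (f : (Fin d → ℝ) → ℝ) (y : Fin d → ℝ) : ℝ :=
  fderiv ℝ f y (Pi.single i 1)

/-- The `(i, j)` entry of `B_δ + B_δ ∇_y 𝒳_δ - Ā - ∇_y · Φ_δ` at the point `y ∈ ℝ^d`, where
`B_δ(y) = A(y/δ_1, …, y/δ_n)` and `(∇_y · Φ_δ)_{ij} = ∑_l ∂_{y^l} Φ_{δ,lij}`. -/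
def fluxDefect {d n : ℕ} (δ : Fin n → ℝ) (A : Vars d n → Matrix (Fin d) (Fin d) ℝ)
    (X : Fin d → Vars d n → ℝ) (U : Fin d → Fin d → Vars d n → ℝ) (i j : Fin d)
    (y : Fin d → ℝ) : ℝ :=
  atScales δ A y i j + ∑ k, atScales δ A y i k * pd k (atScales δ (X j)) y
    - effective δ A X i j
    - ∑ l, pd l (atScales δ (fluxCorrector δ U l i j)) y

/-- The scale-separation condition `ε_j ≤ c_j ε_{j-1} / (1 + log (ε_1/ε_{j-1}))`, `2 ≤ j ≤ n`,
for `n = m + 1` scales; with indices from zero, `ε 0` is the largest scale. -/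
def ScaleSeparated {m : ℕ} (c : Fin m → ℝ) (ε : Fin (m + 1) → ℝ) : Prop :=
  ∀ j : Fin m, ε j.succ ≤ c j * ε j.castSucc / (1 + Real.log (ε 0 / ε j.castSucc))

/-- `max_j exp (-κ ε_{j-1}/ε_j)` over `2 ≤ j ≤ n`, for `n = m + 1 ≥ 2` scales. -/
def resonance {m : ℕ} (κ : ℝ) (ε : Fin (m + 1) → ℝ) : ℝ :=
  ⨆ j : Fin m, Real.exp (-(κ * (ε j.castSucc / ε j.succ)))

end Multiscale

end

/-! The parameter `x` is fixed throughout and all work is done on the Fourier side of the torus in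
`y`, where `∇̂_n` becomes multiplication by `i p_k`, with `p_k = symb δ k`.

Since `A` is analytic, its Fourier coefficients decay like `exp(-σ₀|k|)`. The operator `-∇̂·A∇̂` is
degenerate, as `∇̂` sees only `d` combinations of the `nd` directions, so there is no elliptic
regularity to use. Instead the energy estimate is run with weights `exp(σ|k|)`. Conjugating
multiplication by `A` with the weight changes its kernel by `(w_k/w_l - 1) â(k-l)`, whose Schur norm
is at most `λ/2` once `σ` is small, and ellipticity absorbs it. Thus `∇̂𝒳` and the flux have
coefficients of size `M exp(-σ|k|)`, with `σ`, `M` independent of `δ` and `τ` (`energy_le`,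
`exists_corrector`).

The corrector equation says that the divergence of the `j`-th column of the flux is `τ²𝒳^j`.
Applying `-Δ̂ + τ²` to the defect therefore leaves only terms with a factor `τ²`: `(|p_k|² + τ²)
D̂(k) = -τ² (ĥ(k) + i p_{k,i} X̂(k))`, where `h = Ā - A - A∇̂𝒳` (`coef_torusDefect`).

It remains to divide by `|p_k|² + τ²`. At `k = 0` the right side vanishes. For `k ≠ 0`, either
`|p_k|² ≥ 1` and the factor `τ²` survives, or a coarser scale nearly cancels a finer one, which
forces `|k|` to be at least a multiple of some `ε_{j-1}/ε_j` (`one_le_symb_or`). In the second case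
`τ²` is lost in the division, but half of the exponential decay is bounded by the resonance, hence
by `Kτ²`. Summing over `k` gives a bound of order `τ²`, and `τ ≤ K`. -/

namespace Multiscale

open scoped ComplexConjugate

/-! ### Characters of the torus -/

/-- The Fourier modes on the torus `ℝ^{d×n}/ℤ^{d×n}`. -/
abbrev Modes (d n : ℕ) : Type := Fin n → Fin d → ℤ

/-- The linear form `y ↦ k · y`. -/
noncomputable def phase {d n : ℕ} (k : Modes d n) : Vars d n →L[ℝ] ℝ :=
  ∑ s, ∑ i, (k s i : ℝ) •
    ((ContinuousLinearMap.proj i : (Fin d → ℝ) →L[ℝ] ℝ).comp (ContinuousLinearMap.proj s))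

/-- The character `y ↦ exp (2πi k · y)`. -/
noncomputable def wave {d n : ℕ} (k : Modes d n) (y : Vars d n) : ℂ :=
  Complex.exp (((2 * Real.pi * phase k y : ℝ) : ℂ) * Complex.I)

/-- The Fourier coefficients of a real periodic function. -/
noncomputable def coef {d n : ℕ} (f : Vars d n → ℝ) (k : Modes d n) : ℂ :=
  ∫ y in Set.Icc (0 : Vars d n) 1, (f y : ℂ) * wave (-k) y

section Wave

variable {d n : ℕ}

theorem phase_apply (k : Modes d n) (y : Vars d n) :
    phase k y = ∑ s, ∑ i, (k s i : ℝ) * y s i := by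
  simp [phase]

theorem phase_dir (k : Modes d n) (s : Fin n) (i : Fin d) : phase k (dir s i) = k s i := by
  rw [phase_apply, Finset.sum_eq_single s, Finset.sum_eq_single i]
  · simp [dir]
  · intro b _ hb; simp [dir, hb]
  · simp
  · intro b _ hb; simp [dir, hb]
  · simp

theorem wave_add (k l : Modes d n) (y : Vars d n) : wave (k + l) y = wave k y * wave l y := by
  rw [wave, wave, wave, ← Complex.exp_add]
  congr 1
  have : phase (k + l) y = phase k y + phase l y := by
    simp [phase_apply, add_mul, Finset.sum_add_distrib]
  rw [this]; push_cast; ring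

theorem wave_zero (y : Vars d n) : wave (0 : Modes d n) y = 1 := by
  simp [wave, phase_apply]

theorem wave_neg (k : Modes d n) (y : Vars d n) : wave (-k) y = conj (wave k y) := by
  rw [wave, wave, ← Complex.exp_conj]
  have : phase (-k) y = - phase k y := by simp [phase_apply]
  rw [this, map_mul, Complex.conj_ofReal, Complex.conj_I]
  congr 1
  push_cast; ring

theorem norm_wave (k : Modes d n) (y : Vars d n) : ‖wave k y‖ = 1 :=
  Complex.norm_exp_ofReal_mul_I _

theorem contDiff_wave (k : Modes d n) : ContDiff ℝ ∞ (wave k) := by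
  unfold wave
  apply ContDiff.cexp
  apply ContDiff.mul _ contDiff_const
  exact Complex.ofRealCLM.contDiff.comp (contDiff_const.mul (phase k).contDiff)

theorem continuous_wave (k : Modes d n) : Continuous (wave k) := (contDiff_wave k).continuous

theorem wave_periodic (k : Modes d n) : IsCellPeriodic (wave k) := by
  intro y z
  have h : phase k (fun s i => y s i + (z s i : ℝ))
      = phase k y + ((∑ s, ∑ i, k s i * z s i : ℤ) : ℝ) := by
    simp [phase_apply, mul_add, Finset.sum_add_distrib]
  rw [wave, wave, h, Complex.exp_eq_exp_iff_exists_int]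
  exact ⟨∑ s, ∑ i, k s i * z s i, by push_cast; ring⟩

theorem fderiv_wave (k : Modes d n) (y v : Vars d n) :
    fderiv ℝ (wave k) y v = ((2 * Real.pi * phase k v : ℝ) : ℂ) * Complex.I * wave k y := by
  have h1 : HasFDerivAt (fun y => ((2 * Real.pi * phase k y : ℝ) : ℂ) * Complex.I)
      (((Complex.ofRealCLM.comp ((2 * Real.pi) • phase k)).smulRight Complex.I)) y := by
    have := (Complex.ofRealCLM.comp ((2 * Real.pi) • phase k)).smulRight Complex.I
      |>.hasFDerivAt (x := y)
    convert this using 1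
    ext y
    simp
  have h2 := h1.cexp.fderiv
  change fderiv ℝ (wave k) y = _ at h2
  rw [h2]
  simp [wave]
  ring

end Wave

/-! ### Integration over the periodicity cell -/

section Cell

variable {d n : ℕ}

theorem volume_preserving_curry :
    MeasurePreserving (MeasurableEquiv.curry (Fin n) (Fin d) ℝ) volume volume := by
  apply MeasurePreserving.symm (MeasurableEquiv.curry (Fin n) (Fin d) ℝ).symm
  refine ⟨(MeasurableEquiv.curry (Fin n) (Fin d) ℝ).symm.measurable, ?_⟩
  symm
  apply Measure.pi_eq
  intro s hs
  rw [MeasurableEquiv.map_apply]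
  have : (MeasurableEquiv.curry (Fin n) (Fin d) ℝ).symm ⁻¹' (Set.univ.pi s)
      = Set.univ.pi (fun k => Set.univ.pi (fun i => s (k, i))) := by
    ext x
    simp [MeasurableEquiv.coe_curry_symm, Set.mem_pi, Function.uncurry]
  rw [this, volume_pi_pi]
  simp_rw [volume_pi_pi]
  rw [Fintype.prod_prod_type]

/-- Uncurried variables and a half-open box are the form in which integrals over `UnitAddTorus` are
expressed. -/
theorem integral_cell (g : Vars d n → ℂ) :
    ∫ y in Set.Icc (0 : Vars d n) 1, g y
      = ∫ x in {x : Fin n × Fin d → ℝ | ∀ i, x i ∈ Set.Ioc (0 : ℝ) (0 + 1)},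
          g (Function.curry x) := by
  rw [← volume_preserving_curry.setIntegral_preimage_emb
    (MeasurableEquiv.curry (Fin n) (Fin d) ℝ).measurableEmbedding]
  apply setIntegral_congr_set
  have h1 : (MeasurableEquiv.curry (Fin n) (Fin d) ℝ) ⁻¹' (Set.Icc (0 : Vars d n) 1)
      = Set.Icc (0 : Fin n × Fin d → ℝ) 1 := by
    ext x
    simp [MeasurableEquiv.coe_curry, Pi.le_def, Function.curry]
  have h2 : {x : Fin n × Fin d → ℝ | ∀ i, x i ∈ Set.Ioc (0 : ℝ) (0 + 1)}
      = Set.univ.pi fun i => Set.Ioc ((0 : Fin n × Fin d → ℝ) i) ((1 : Fin n × Fin d → ℝ) i) := by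
    ext x; simp
  rw [h1, h2]
  exact Measure.univ_pi_Ioc_ae_eq_Icc.symm

/-- A periodic function descends to the torus. -/
theorem exists_torus_lift {g : Vars d n → ℂ} (hg : IsCellPeriodic g) :
    ∃ G : UnitAddTorus (Fin n × Fin d) → ℂ,
      (∀ x : Fin n × Fin d → ℝ, G (fun i => x i) = g (Function.curry x)) ∧
      (Continuous g → Continuous G) := by
  -- The lift evaluates `g` at the representatives in `(0,1]`; by periodicity any other
  -- representative gives the same value.
  have key : ∀ x : Fin n × Fin d → ℝ,
      g (fun s i => (AddCircle.equivIoc (1 : ℝ) 0 ((x (s, i) : ℝ) : UnitAddCircle)).1)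
        = g (Function.curry x) := by
    intro x
    have hx : ∀ i, ∃ z : ℤ,
        (AddCircle.equivIoc (1 : ℝ) 0 (x i : UnitAddCircle)).1 = x i + z := by
      intro i
      have h : ((AddCircle.equivIoc (1 : ℝ) 0 (x i : UnitAddCircle)).1 : UnitAddCircle) = x i :=
        AddCircle.coe_equivIoc
      rw [← sub_eq_zero, ← AddCircle.coe_sub, AddCircle.coe_eq_zero_iff] at h
      obtain ⟨z, hz⟩ := h
      refine ⟨z, ?_⟩
      simp only [zsmul_eq_mul, mul_one] at hz
      linarith
    choose z hz using hx
    rw [← hg (Function.curry x) (fun s i => z (s, i))]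
    congr 1
    funext s i
    exact hz (s, i)
  refine ⟨fun t => g (fun s i => (AddCircle.equivIoc (1 : ℝ) 0 (t (s, i))).1), key, ?_⟩
  intro hc
  -- The choice of representative is discontinuous, so continuity is tested upstairs: a product of
  -- open quotient maps is a quotient map.
  have hq : IsOpenQuotientMap (Pi.map fun (_ : Fin n × Fin d) (x : ℝ) => (x : UnitAddCircle)) :=
    IsOpenQuotientMap.piMap fun _ => QuotientAddGroup.isOpenQuotientMap_mk
  rw [hq.isQuotientMap.continuous_iff]
  have : Continuous fun x : Fin n × Fin d → ℝ => g (Function.curry x) := by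
    apply hc.comp
    exact continuous_pi fun s => continuous_pi fun i => continuous_apply (s, i)
  exact this.congr fun x => (key x).symm

/-- Both sides are the integral of the lift over the torus, computed in two different unit boxes. -/
theorem integral_cell_add {g : Vars d n → ℂ} (hg : IsCellPeriodic g) (a : Vars d n) :
    ∫ y in Set.Icc (0 : Vars d n) 1, g (y + a) = ∫ y in Set.Icc (0 : Vars d n) 1, g y := by
  obtain ⟨G, hG, -⟩ := exists_torus_lift hg
  set b : Fin n × Fin d → ℝ := Function.uncurry a with hb
  have h := (UnitAddTorus.integral_preimage G 0).symm.trans (UnitAddTorus.integral_preimage G b)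
  simp_rw [hG] at h
  rw [integral_cell, integral_cell]
  refine Eq.trans ?_ h.symm
  rw [← (measurePreserving_add_right volume b).setIntegral_preimage_emb
    (measurableEmbedding_addRight b) (fun x => g (Function.curry x))
    {x | ∀ i, x i ∈ Set.Ioc (b i) (b i + 1)}]
  have : (fun x => x + b) ⁻¹' {x : Fin n × Fin d → ℝ | ∀ i, x i ∈ Set.Ioc (b i) (b i + 1)}
      = {x | ∀ i, x i ∈ Set.Ioc (0 : ℝ) (0 + 1)} := by
    ext x
    simp [add_comm (b _) 1]
  rw [this]
  rfl

theorem IsCellPeriodic.fderiv {F : Type*} [NormedAddCommGroup F] [NormedSpace ℝ F]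
    {g : Vars d n → F} (hg : IsCellPeriodic g) : IsCellPeriodic (fderiv ℝ g) := by
  intro y z
  have : (fun y => g (y + fun k i => (z k i : ℝ))) = g := funext fun y => hg y z
  conv_rhs => rw [← this]
  rw [fderiv_comp_add_right]
  rfl

/-- Translating by `t v` does not change the integral. Averaging over `t ∈ [0,1]` and exchanging the
integrals leaves the mean of `g (y + v) - g y`, which is zero. No boundary terms appear, and `v`
need not be a period. -/
theorem integral_cell_fderiv {g : Vars d n → ℂ} (hg : IsCellPeriodic g) (hd : ContDiff ℝ 1 g)
    (v : Vars d n) : ∫ y in Set.Icc (0 : Vars d n) 1, fderiv ℝ g y v = 0 := by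
  have hc : Continuous fun y => fderiv ℝ g y v :=
    (hd.continuous_fderiv one_ne_zero).clm_apply continuous_const
  have hp : IsCellPeriodic fun y => fderiv ℝ g y v := fun y z => by
    change fderiv ℝ g _ v = _
    rw [hg.fderiv y z]
  have hgi : ∀ h : Vars d n → ℂ, Continuous h →
      Integrable h (volume.restrict (Set.Icc (0 : Vars d n) 1)) :=
    fun h hh => hh.continuousOn.integrableOn_compact isCompact_Icc
  have hft : ∀ y, ∫ t in (0 : ℝ)..1, fderiv ℝ g (y + t • v) v = g (y + v) - g y := by
    intro y
    have h1 : ∀ t ∈ Set.uIcc (0 : ℝ) 1,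
        HasDerivAt (fun t : ℝ => g (y + t • v)) (fderiv ℝ g (y + t • v) v) t := by
      intro t _
      have h2 : HasDerivAt (fun t : ℝ => y + t • v) v t := by
        simpa using ((hasDerivAt_id t).smul_const v).const_add y
      exact ((hd.differentiable one_ne_zero) _).hasFDerivAt.comp_hasDerivAt t h2
    rw [intervalIntegral.integral_eq_sub_of_hasDerivAt h1]
    · simp
    · apply Continuous.intervalIntegrable
      exact hc.comp (by fun_prop)
  have h1 : ∫ t in (0 : ℝ)..1, ∫ y in Set.Icc (0 : Vars d n) 1, fderiv ℝ g (y + t • v) v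
      = ∫ y in Set.Icc (0 : Vars d n) 1, fderiv ℝ g y v := by
    have : ∀ t : ℝ, ∫ y in Set.Icc (0 : Vars d n) 1, fderiv ℝ g (y + t • v) v
        = ∫ y in Set.Icc (0 : Vars d n) 1, fderiv ℝ g y v := fun t => integral_cell_add hp (t • v)
    simp_rw [this]
    simp
  rw [← h1, MeasureTheory.intervalIntegral_integral_swap]
  · simp_rw [hft]
    rw [integral_sub, integral_cell_add hg, sub_self]
    · exact hgi _ (hd.continuous.comp (continuous_id.add continuous_const))
    · exact hgi _ hd.continuous
  · rw [Measure.prod_restrict]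
    have : IntegrableOn (Function.uncurry fun (t : ℝ) (y : Vars d n) => fderiv ℝ g (y + t • v) v)
        (Set.uIcc (0 : ℝ) 1 ×ˢ Set.Icc (0 : Vars d n) 1) (volume.prod volume) := by
      apply ContinuousOn.integrableOn_compact (isCompact_uIcc.prod isCompact_Icc)
      apply Continuous.continuousOn
      exact hc.comp (by fun_prop)
    exact this.mono_set (Set.prod_mono Set.uIoc_subset_uIcc le_rfl)

theorem integrable_cell {F : Type*} [NormedAddCommGroup F] {h : Vars d n → F}
    (hh : Continuous h) : Integrable h (volume.restrict (Set.Icc (0 : Vars d n) 1)) :=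
  hh.continuousOn.integrableOn_compact isCompact_Icc

instance isProbabilityMeasure_cell :
    IsProbabilityMeasure (volume.restrict (Set.Icc (0 : Vars d n) 1)) := by
  constructor
  rw [Measure.restrict_apply_univ, ← Set.pi_univ_Icc, volume_pi_pi]
  apply Finset.prod_eq_one
  intro i _
  rw [← Set.pi_univ_Icc, volume_pi_pi]
  simp

theorem integral_wave (k : Modes d n) :
    ∫ y in Set.Icc (0 : Vars d n) 1, wave k y = if k = 0 then 1 else 0 := by
  split_ifs with h
  · subst h
    simp_rw [wave_zero]
    simp
  · obtain ⟨s, hs⟩ := Function.ne_iff.mp h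
    obtain ⟨i, hi⟩ := Function.ne_iff.mp hs
    have := integral_cell_fderiv (wave_periodic k) ((contDiff_wave k).of_le (by simp)) (dir s i)
    simp_rw [fderiv_wave, phase_dir] at this
    rw [integral_const_mul] at this
    have hne : ((2 * Real.pi * (k s i : ℝ) : ℝ) : ℂ) * Complex.I ≠ 0 := by
      have : (k s i : ℝ) ≠ 0 := by exact_mod_cast hi
      apply mul_ne_zero _ Complex.I_ne_zero
      norm_cast
      positivity
    exact (mul_eq_zero.mp this).resolve_left hne

end Cell

/-! ### Fourier coefficients: linearity, derivatives, inversion -/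

section Coef

variable {d n : ℕ}

theorem continuous_coef_integrand {f : Vars d n → ℝ} (hf : Continuous f) (k : Modes d n) :
    Continuous fun y => (f y : ℂ) * wave (-k) y :=
  (Complex.continuous_ofReal.comp hf).mul (continuous_wave _)

theorem coef_add {f g : Vars d n → ℝ} (hf : Continuous f) (hg : Continuous g) (k : Modes d n) :
    coef (fun y => f y + g y) k = coef f k + coef g k := by
  simp only [coef]
  rw [← integral_add (integrable_cell (continuous_coef_integrand hf k))
    (integrable_cell (continuous_coef_integrand hg k))]
  congr 1
  ext y
  push_cast
  ring

theorem coef_const_mul (c : ℝ) (f : Vars d n → ℝ) (k : Modes d n) :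
    coef (fun y => c * f y) k = c * coef f k := by
  simp only [coef]
  rw [← integral_const_mul]
  congr 1
  ext y
  push_cast
  ring

theorem coef_neg_fun (f : Vars d n → ℝ) (k : Modes d n) :
    coef (fun y => - f y) k = - coef f k := by
  simpa using coef_const_mul (-1) f k

theorem coef_sub {f g : Vars d n → ℝ} (hf : Continuous f) (hg : Continuous g) (k : Modes d n) :
    coef (fun y => f y - g y) k = coef f k - coef g k := by
  simp only [sub_eq_add_neg]
  rw [← coef_neg_fun]
  exact coef_add hf hg.neg k

theorem coef_sum {ι : Type*} (s : Finset ι) {f : ι → Vars d n → ℝ} (hf : ∀ i, Continuous (f i))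
    (k : Modes d n) : coef (fun y => ∑ i ∈ s, f i y) k = ∑ i ∈ s, coef (f i) k := by
  simp only [coef]
  rw [← integral_finsetSum _ fun i _ => integrable_cell (continuous_coef_integrand (hf i) k)]
  congr 1
  ext y
  push_cast
  rw [Finset.sum_mul]

theorem coef_const (c : ℝ) (k : Modes d n) :
    coef (fun _ => c) k = if k = 0 then (c : ℂ) else 0 := by
  simp only [coef]
  rw [integral_const_mul, integral_wave]
  simp

theorem coef_zero_index (f : Vars d n → ℝ) : coef f 0 = ((cellAverage f : ℝ) : ℂ) := by
  simp only [coef, cellAverage, neg_zero, wave_zero, mul_one]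
  exact integral_complex_ofReal

theorem norm_coef_le {f : Vars d n → ℝ} {B : ℝ} (hB : ∀ y, |f y| ≤ B) (k : Modes d n) :
    ‖coef f k‖ ≤ B := by
  have := norm_integral_le_of_norm_le_const (μ := volume.restrict (Set.Icc (0 : Vars d n) 1))
    (f := fun y => (f y : ℂ) * wave (-k) y) (C := B)
    (Filter.Eventually.of_forall fun y => by simpa [norm_wave] using hB y)
  rw [coef]
  simpa using this

theorem coef_neg (f : Vars d n → ℝ) (k : Modes d n) : coef f (-k) = conj (coef f k) := by
  simp only [coef]
  rw [← integral_conj]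
  congr 1
  ext y
  rw [map_mul, Complex.conj_ofReal, ← wave_neg]

/-- Integration by parts: the derivative of the periodic function `f * wave (-k)` has mean zero. -/
theorem coef_fderiv {f : Vars d n → ℝ} (hp : IsCellPeriodic f) (hf : ContDiff ℝ 1 f)
    (v : Vars d n) (k : Modes d n) :
    coef (fun y => fderiv ℝ f y v) k
      = ((2 * Real.pi * phase k v : ℝ) : ℂ) * Complex.I * coef f k := by
  have hc : ContDiff ℝ 1 fun y => (f y : ℂ) * wave (-k) y :=
    (Complex.ofRealCLM.contDiff.comp hf).mul ((contDiff_wave _).of_le (by simp))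
  have hpc : IsCellPeriodic fun y => (f y : ℂ) * wave (-k) y := fun y z => by
    change ((f _ : ℝ) : ℂ) * wave (-k) _ = _
    rw [hp y z, wave_periodic (-k) y z]
  have h0 := integral_cell_fderiv hpc hc v
  have hder : ∀ y, fderiv ℝ (fun y => (f y : ℂ) * wave (-k) y) y v
      = ((fderiv ℝ f y v : ℝ) : ℂ) * wave (-k) y
        - ((2 * Real.pi * phase k v : ℝ) : ℂ) * Complex.I * ((f y : ℂ) * wave (-k) y) := by
    intro y
    have h1 : HasFDerivAt (fun y => (f y : ℂ)) (Complex.ofRealCLM.comp (fderiv ℝ f y)) y :=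
      Complex.ofRealCLM.hasFDerivAt.comp y ((hf.differentiable one_ne_zero) y).hasFDerivAt
    have h2 : HasFDerivAt (wave (-k)) (fderiv ℝ (wave (-k)) y) y :=
      (((contDiff_wave (-k)).differentiable (by simp)) y).hasFDerivAt
    have h4 : fderiv ℝ (fun y => (f y : ℂ) * wave (-k) y) y = _ := (h1.mul h2).fderiv
    rw [h4]
    have h3 : phase (-k) v = - phase k v := by simp [phase_apply]
    simp [fderiv_wave, h3]
    ring
  simp_rw [hder] at h0
  have hcf : Continuous fun y => fderiv ℝ f y v :=
    (hf.continuous_fderiv one_ne_zero).clm_apply continuous_const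
  rw [integral_sub (integrable_cell (continuous_coef_integrand hcf k))
    ((integrable_cell (continuous_coef_integrand hf.continuous k)).const_mul _),
    integral_const_mul, sub_eq_zero] at h0
  exact h0

/-- Fourier inversion for continuous functions on the torus with summable coefficients, carried back
along the lift. -/
theorem hasSum_coef {f : Vars d n → ℝ} (hf : Continuous f) (hp : IsCellPeriodic f)
    (hs : Summable (coef f)) (y : Vars d n) :
    HasSum (fun k => coef f k * wave k y) (f y : ℂ) := by
  have hpc : IsCellPeriodic fun y => (f y : ℂ) := fun y z => by
    change ((f _ : ℝ) : ℂ) = _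
    rw [hp y z]
  obtain ⟨G, hG, hGc⟩ := exists_torus_lift hpc
  let F : C(UnitAddTorus (Fin n × Fin d), ℂ) :=
    ⟨G, hGc (Complex.continuous_ofReal.comp hf)⟩
  let e : (Fin n × Fin d → ℤ) ≃ Modes d n := Equiv.curry _ _ _
  have hw : ∀ (k : Fin n × Fin d → ℤ) (x : Fin n × Fin d → ℝ),
      UnitAddTorus.mFourier k (fun i => (x i : UnitAddCircle))
        = wave (e k) (Function.curry x) := by
    intro k x
    change ∏ i, fourier (k i) (x i : UnitAddCircle) = _
    simp_rw [fourier_coe_apply]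
    rw [← Complex.exp_sum, wave, phase_apply, Fintype.sum_prod_type]
    congr 1
    push_cast
    simp only [Finset.mul_sum, Finset.sum_mul, e, Equiv.curry_apply, Function.curry]
    refine Finset.sum_congr rfl fun s _ => Finset.sum_congr rfl fun i _ => ?_
    simp
    ring
  have hco : ∀ k, UnitAddTorus.mFourierCoeff F k = coef f (e k) := by
    intro k
    rw [UnitAddTorus.mFourierCoeff_eq_integral _ _ 0, coef, integral_cell]
    congr 1
    ext x
    rw [hw]
    change _ * G _ = _
    rw [hG, mul_comm]
    rfl
  have hsF : Summable (UnitAddTorus.mFourierCoeff F) := by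
    rw [show UnitAddTorus.mFourierCoeff F = coef f ∘ e from funext hco]
    exact (e.summable_iff).mpr hs
  have := UnitAddTorus.hasSum_mFourier_series_apply_of_summable hsF
    (fun i => ((Function.uncurry y) i : UnitAddCircle))
  simp_rw [hco, hw] at this
  rw [show (F fun i => ((Function.uncurry y i : ℝ) : UnitAddCircle)) = (f y : ℂ) from hG _] at this
  rw [← e.hasSum_iff]
  exact this

end Coef

/-! ### Length of modes and summability of exponential weights -/

/-- The `ℓ¹` length of a Fourier mode. -/
noncomputable def size {d n : ℕ} (k : Modes d n) : ℝ := ∑ s, ∑ i, |(k s i : ℝ)|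

section Size

variable {d n : ℕ}

theorem size_nonneg (k : Modes d n) : 0 ≤ size k :=
  Finset.sum_nonneg fun _ _ => Finset.sum_nonneg fun _ _ => abs_nonneg _

theorem size_neg (k : Modes d n) : size (-k) = size k := by simp [size]

theorem size_add_le (k l : Modes d n) : size (k + l) ≤ size k + size l := by
  simp only [size, ← Finset.sum_add_distrib]
  refine Finset.sum_le_sum fun s _ => Finset.sum_le_sum fun i _ => ?_
  simpa using abs_add_le (k s i : ℝ) (l s i)

theorem size_le_sub_add (k l : Modes d n) : size k ≤ size (k - l) + size l := by
  simpa using size_add_le (k - l) l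

theorem norm_phase_le (k : Modes d n) : ‖phase k‖ ≤ size k := by
  refine ContinuousLinearMap.opNorm_le_bound _ (size_nonneg k) fun y => ?_
  rw [phase_apply, size, Finset.sum_mul]
  refine (norm_sum_le _ _).trans (Finset.sum_le_sum fun s _ => ?_)
  rw [Finset.sum_mul]
  refine (norm_sum_le _ _).trans (Finset.sum_le_sum fun i _ => ?_)
  rw [norm_mul, Real.norm_eq_abs]
  exact mul_le_mul_of_nonneg_left ((norm_le_pi_norm (y s) i).trans (norm_le_pi_norm y s))
    (abs_nonneg _)

/-- A finite set of indices lies in a finite box, over which the sum of products factors. -/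
theorem summable_pi_prod {ι β : Type*} [Fintype ι] {f : β → ℝ} (h0 : ∀ b, 0 ≤ f b)
    (hf : Summable f) : Summable fun x : ι → β => ∏ i, f (x i) := by
  classical
  refine summable_of_sum_le (c := ∏ _i : ι, ∑' b, f b)
    (fun x => Finset.prod_nonneg fun i _ => h0 _) fun S => ?_
  calc ∑ x ∈ S, ∏ i, f (x i)
      ≤ ∑ x ∈ Fintype.piFinset fun i => S.image fun x => x i, ∏ i, f (x i) := by
        refine Finset.sum_le_sum_of_subset_of_nonneg (fun x hx => ?_)
          fun x _ _ => Finset.prod_nonneg fun i _ => h0 _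
        exact Fintype.mem_piFinset.mpr fun i => Finset.mem_image_of_mem _ hx
    _ = ∏ i, ∑ b ∈ S.image fun x => x i, f b := by rw [Finset.prod_univ_sum]
    _ ≤ _ := Finset.prod_le_prod (fun i _ => Finset.sum_nonneg fun b _ => h0 b)
        fun i _ => hf.sum_le_tsum _ fun b _ => h0 b

theorem summable_exp_size {σ : ℝ} (hσ : 0 < σ) :
    Summable fun k : Modes d n => Real.exp (-(σ * size k)) := by
  have h1 : Summable fun z : ℤ => Real.exp (-(σ * |(z : ℝ)|)) := by
    have h : Summable fun j : ℕ => Real.exp (-(σ * (j : ℝ))) := by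
      have := Real.summable_exp_nat_mul_iff.mpr (neg_lt_zero.mpr hσ)
      refine this.congr fun j => ?_
      congr 1
      ring
    exact Summable.of_nat_of_neg (by simpa using h) (by simpa using h)
  have h2 := summable_pi_prod (ι := Fin n) (fun _ => Finset.prod_nonneg fun _ _ => (Real.exp_pos _).le)
    (summable_pi_prod (ι := Fin d) (f := fun z : ℤ => Real.exp (-(σ * |(z : ℝ)|)))
      (fun z => (Real.exp_pos _).le) h1)
  refine h2.congr fun k => ?_
  simp_rw [← Real.exp_sum]
  congr 1
  simp [size, Finset.mul_sum]

/-- The largest of the `n * d` entries is at least their average. -/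
theorem exists_size_le [Nonempty (Fin n)] [Nonempty (Fin d)] (k : Modes d n) :
    ∃ s i, size k ≤ (n * d : ℕ) * |(k s i : ℝ)| := by
  by_contra! h
  have h1 : ∑ p : Fin n × Fin d, ((n * d : ℕ) * |(k p.1 p.2 : ℝ)|)
      < ∑ _p : Fin n × Fin d, size k :=
    Finset.sum_lt_sum_of_nonempty Finset.univ_nonempty fun p _ => h p.1 p.2
  rw [← Finset.mul_sum, Fintype.sum_prod_type] at h1
  simp [size] at h1

end Size

/-! ### Functions with prescribed Fourier coefficients -/

section Synth

variable {d n : ℕ}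

/-- The function with given (hermitian, rapidly decaying) Fourier coefficients. -/
noncomputable def synth (x : Modes d n → ℂ) (y : Vars d n) : ℝ := ∑' k, (x k * wave k y).re

/-- The wave is `θ ↦ exp(2πiθ)` composed with the linear form `phase k`, whose norm is at most `size
k`. -/
theorem norm_iteratedFDeriv_wave_le (k : Modes d n) (j : ℕ) (y : Vars d n) :
    ‖iteratedFDeriv ℝ j (wave k) y‖ ≤ (2 * Real.pi * size k) ^ j := by
  let c : ℝ → ℂ := fun θ => Complex.exp (((2 * Real.pi * θ : ℝ) : ℂ) * Complex.I)
  have hc : ContDiff ℝ ∞ c := by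
    apply ContDiff.cexp
    apply ContDiff.mul _ contDiff_const
    exact Complex.ofRealCLM.contDiff.comp (contDiff_const.mul contDiff_id)
  have hj : ∀ j, iteratedDeriv j c = fun θ => (((2 * Real.pi : ℝ) : ℂ) * Complex.I) ^ j * c θ := by
    intro j
    induction j with
    | zero => simp
    | succ j ih =>
      rw [iteratedDeriv_succ, ih]
      ext θ
      have h1 : HasDerivAt (fun θ : ℝ => ((2 * Real.pi * θ : ℝ) : ℂ) * Complex.I)
          (((2 * Real.pi : ℝ) : ℂ) * Complex.I) θ := by
        have := (((hasDerivAt_id θ).const_mul (2 * Real.pi)).ofReal_comp).mul_const Complex.I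
        simpa using this
      have h2 : HasDerivAt c _ θ := h1.cexp
      rw [(h2.const_mul _).deriv]
      simp only [c]
      ring
  have hw : wave k = c ∘ phase k := rfl
  rw [hw, (phase k).iteratedFDeriv_comp_right hc y (by exact_mod_cast le_top)]
  refine (ContinuousMultilinearMap.norm_compContinuousLinearMap_le _ _).trans ?_
  rw [norm_iteratedFDeriv_eq_norm_iteratedDeriv, hj]
  have h1 : ‖c (phase k y)‖ = 1 := Complex.norm_exp_ofReal_mul_I _
  rw [norm_mul, h1, norm_pow, norm_mul, Complex.norm_I, Complex.norm_real, Real.norm_eq_abs,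
    abs_of_pos Real.two_pi_pos, mul_one, mul_one, Finset.prod_const, Finset.card_univ,
    Fintype.card_fin, ← mul_pow]
  exact pow_le_pow_left₀ (by positivity)
    (mul_le_mul_of_nonneg_left (norm_phase_le k) Real.two_pi_pos.le) _

variable {x : Modes d n → ℂ} {M σ : ℝ}

theorem summable_norm_of_decay (hσ : 0 < σ) (hx : ∀ k, ‖x k‖ ≤ M * Real.exp (-(σ * size k))) :
    Summable fun k => ‖x k‖ :=
  Summable.of_nonneg_of_le (fun _ => norm_nonneg _) hx ((summable_exp_size hσ).mul_left M)

/-- Termwise differentiation. The factor `(2π|k|)^j` is absorbed by half of the exponential, through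
`s^j / j! ≤ exp s` with `s = σ|k|/2`; the other half is summed. -/
theorem contDiff_synth (hσ : 0 < σ) (hx : ∀ k, ‖x k‖ ≤ M * Real.exp (-(σ * size k))) :
    ContDiff ℝ ∞ (synth x) := by
  have hM : 0 ≤ M := by
    by_contra! h
    have := (norm_nonneg _).trans (hx 0)
    nlinarith [Real.exp_pos (-(σ * size (0 : Modes d n)))]
  let L : Modes d n → ℂ →L[ℝ] ℝ := fun k =>
    Complex.reCLM.comp (ContinuousLinearMap.mul ℝ ℂ (x k))
  have hL : ∀ k, ‖L k‖ ≤ ‖x k‖ := fun k =>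
    ContinuousLinearMap.opNorm_le_bound _ (norm_nonneg _) fun z => by
      simpa [L] using (Complex.abs_re_le_norm (x k * z))
  have heq : synth x = fun y => ∑' k, (L k ∘ wave k) y := by
    ext y; simp [synth, L]
  rw [heq]
  refine contDiff_tsum (v := fun j k => ‖x k‖ * (2 * Real.pi * size k) ^ j)
    (fun k => (L k).contDiff.comp (contDiff_wave k)) ?_ ?_
  · intro j _
    have hs := (summable_exp_size (d := d) (n := n) (half_pos hσ)).mul_left
      (M * ((2 * Real.pi) ^ j * ((2 / σ) ^ j * (j ! : ℝ))))
    refine Summable.of_nonneg_of_le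
      (fun k => mul_nonneg (norm_nonneg _)
        (pow_nonneg (mul_nonneg Real.two_pi_pos.le (size_nonneg k)) _)) (fun k => ?_) hs
    have h1 := Real.pow_div_factorial_le_exp (σ / 2 * size k)
      (mul_nonneg (half_pos hσ).le (size_nonneg k)) j
    rw [div_le_iff₀ (by positivity)] at h1
    have h2 : size k ^ j = (2 / σ) ^ j * (σ / 2 * size k) ^ j := by
      rw [← mul_pow]
      congr 1
      field_simp
    have h3 : Real.exp (-(σ * size k))
        = Real.exp (-(σ / 2 * size k)) * Real.exp (-(σ / 2 * size k)) := by
      rw [← Real.exp_add]; congr 1; ring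
    have h4 : Real.exp (-(σ / 2 * size k)) * Real.exp (σ / 2 * size k) = 1 := by
      rw [← Real.exp_add]; simp
    calc ‖x k‖ * (2 * Real.pi * size k) ^ j
        ≤ (M * Real.exp (-(σ * size k))) * ((2 * Real.pi) ^ j * ((2 / σ) ^ j *
            (Real.exp (σ / 2 * size k) * (j ! : ℝ)))) := by
          rw [mul_pow, h2]
          refine mul_le_mul (hx k) ?_ ?_ (mul_nonneg hM (Real.exp_pos _).le)
          · gcongr
          · have := size_nonneg k
            positivity
      _ = M * ((2 * Real.pi) ^ j * ((2 / σ) ^ j * (j ! : ℝ))) * Real.exp (-(σ / 2 * size k))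
            * (Real.exp (-(σ / 2 * size k)) * Real.exp (σ / 2 * size k)) := by
          rw [h3]; ring
      _ = _ := by rw [h4, mul_one]
  · intro j k y _
    refine ((L k).norm_iteratedFDeriv_comp_left (contDiff_wave k).contDiffAt
      (by exact_mod_cast le_top)).trans ?_
    exact mul_le_mul (hL k) (norm_iteratedFDeriv_wave_le k j y) (norm_nonneg _) (norm_nonneg _)

theorem isCellPeriodic_synth (x : Modes d n → ℂ) : IsCellPeriodic (synth x) := by
  intro y z
  simp only [synth]
  congr 1
  ext k
  rw [wave_periodic k y z]

/-- Hermitian symmetry makes the series real, so the real part taken in `synth` loses nothing. -/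
theorem hasSum_synth (hs : Summable fun k => ‖x k‖) (hh : ∀ k, x (-k) = conj (x k))
    (y : Vars d n) : HasSum (fun k => x k * wave k y) (synth x y : ℂ) := by
  have h1 : Summable fun k => x k * wave k y :=
    Summable.of_norm (by simpa [norm_wave] using hs)
  have h2 : conj (∑' k, x k * wave k y) = ∑' k, x k * wave k y := by
    rw [Complex.conj_tsum, ← (Equiv.neg (Modes d n)).tsum_eq]
    refine tsum_congr fun k => ?_
    rw [Equiv.neg_apply, map_mul, hh, wave_neg, Complex.conj_conj, Complex.conj_conj]
  have h3 : (synth x y : ℂ) = ∑' k, x k * wave k y := by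
    rw [synth, ← Complex.re_tsum h1]
    exact Complex.conj_eq_iff_re.mp h2
  rw [h3]
  exact h1.hasSum

/-- The Fourier coefficients of a product. -/
theorem hasSum_coef_mul {f g : Vars d n → ℝ} (hg : Continuous g) (hs : Summable fun k => ‖x k‖)
    (hf : ∀ y, HasSum (fun k => x k * wave k y) (f y : ℂ)) (k : Modes d n) :
    HasSum (fun l => coef g (k - l) * x l) (coef (fun y => g y * f y) k) := by
  have h1 : ∀ l y, (g y : ℂ) * wave (-(k - l)) y * x l
      = (g y : ℂ) * wave (-k) y * (x l * wave l y) := by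
    intro l y
    rw [neg_sub, sub_eq_add_neg, wave_add]
    ring
  have h2 := hasSum_integral_of_summable_integral_norm
    (μ := volume.restrict (Set.Icc (0 : Vars d n) 1))
    (F := fun l y => (g y : ℂ) * wave (-(k - l)) y * x l)
    (fun l => (integrable_cell (continuous_coef_integrand hg (k - l))).mul_const _) ?_
  · simp_rw [integral_mul_const] at h2
    have h3 : coef (fun y => g y * f y) k = ∫ y in Set.Icc (0 : Vars d n) 1,
        ∑' l, (g y : ℂ) * wave (-(k - l)) y * x l := by
      rw [coef]
      congr 1
      ext y
      simp_rw [h1, tsum_mul_left, (hf y).tsum_eq]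
      push_cast
      ring
    rw [h3]
    exact h2
  · simp_rw [norm_mul, norm_wave, mul_one, integral_mul_const]
    exact hs.mul_left _

/-- The product formula with `g = 1`, whose only nonzero coefficient is at `0`, isolates the term `l
= k`. -/
theorem coef_synth (hs : Summable fun k => ‖x k‖) (hh : ∀ k, x (-k) = conj (x k))
    (k : Modes d n) : coef (synth x) k = x k := by
  have h := hasSum_coef_mul (g := fun _ => 1) continuous_const hs (hasSum_synth hs hh) k
  simp only [one_mul, coef_const] at h
  have h2 := hasSum_single (f := fun l => (if k - l = 0 then ((1 : ℝ) : ℂ) else 0) * x l) k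
    (fun l hl => by simp [sub_eq_zero, hl.symm])
  simpa using h.unique h2

end Synth

/-! ### Exponential decay of Fourier coefficients of analytic functions -/

section Decay

variable {d n : ℕ}

theorem abs_iteratedFDeriv_le_absDeriv (j : ℕ) (f : Vars d n → ℝ) (y : Vars d n) (s : Fin n)
    (i : Fin d) : |iteratedFDeriv ℝ j f y fun _ => dir s i| ≤ absDeriv j f y := by
  unfold absDeriv
  let F : (Fin j → Fin n × Fin d) → ℝ := fun J =>
    |iteratedFDeriv ℝ j f y fun r => dir (J r).1 (J r).2|
  have h : F (fun _ => (s, i)) ≤ ∑ J, F J :=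
    Finset.single_le_sum (fun J _ => abs_nonneg _) (Finset.mem_univ _)
  exact h

/-- One repeated direction is enough for the decay estimate. Smoothness and periodicity accompany
the formula in the induction so that `coef_fderiv` applies again. -/
theorem coef_iterated {f : Vars d n → ℝ} (hp : IsCellPeriodic f) (hf : ContDiff ℝ ∞ f)
    (v : Vars d n) (k : Modes d n) (j : ℕ) :
    ContDiff ℝ ∞ (fun y => iteratedFDeriv ℝ j f y fun _ => v) ∧
    IsCellPeriodic (fun y => iteratedFDeriv ℝ j f y fun _ => v) ∧
    coef (fun y => iteratedFDeriv ℝ j f y fun _ => v) k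
      = (((2 * Real.pi * phase k v : ℝ) : ℂ) * Complex.I) ^ j * coef f k := by
  induction j with
  | zero => simpa using ⟨hf, hp⟩
  | succ j ih =>
    obtain ⟨h1, h2, h3⟩ := ih
    have heq : (fun y => iteratedFDeriv ℝ (j + 1) f y fun _ => v)
        = fun y => fderiv ℝ (fun y => iteratedFDeriv ℝ j f y fun _ => v) y v := by
      ext y
      rw [iteratedFDeriv_succ_apply_left]
      rw [fderiv_continuousMultilinear_apply_const_apply]
      · rfl
      · exact (hf.differentiable_iteratedFDeriv (m := j) (by exact_mod_cast WithTop.coe_lt_top _)) y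
    rw [heq]
    refine ⟨?_, fun y z => ?_, ?_⟩
    · exact (h1.fderiv_right (m := ∞) (by simp)).clm_apply contDiff_const
    · change fderiv ℝ _ _ v = _
      rw [h2.fderiv y z]
    · rw [coef_fderiv h2 (h1.of_le (by simp)), h3]
      ring

theorem hasSum_pow_div_factorial (t : ℝ) :
    HasSum (fun j : ℕ => t ^ j / (j ! : ℝ)) (Real.exp t) := by
  rw [Real.exp_eq_exp_ℝ]
  exact NormedSpace.expSeries_div_hasSum_exp t

/-- Analytic bounds give exponential decay of the Fourier coefficients. -/
theorem norm_coef_le_exp [Nonempty (Fin n)] [Nonempty (Fin d)] {f : Vars d n → ℝ} {C₀ Λ₀ : ℝ}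
    (hΛ₀ : 0 < Λ₀) (hp : IsCellPeriodic f) (hf : ContDiff ℝ ∞ f)
    (ha : ∀ y j, absDeriv j f y ≤ C₀ * Λ₀ ^ j * (j ! : ℝ)) (k : Modes d n) :
    ‖coef f k‖ ≤ 2 * C₀ * Real.exp (-(Real.pi / (Λ₀ * (n * d : ℕ)) * size k)) := by
  obtain ⟨s, i, hsi⟩ := exists_size_le k
  set t : ℝ := 2 * Real.pi * |(k s i : ℝ)| with ht
  have h1 : ∀ j : ℕ, t ^ j * ‖coef f k‖ ≤ C₀ * Λ₀ ^ j * (j ! : ℝ) := by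
    intro j
    have h2 := (coef_iterated hp hf (dir s i) k j).2.2
    have h3 : ‖coef (fun y => iteratedFDeriv ℝ j f y fun _ => dir s i) k‖
        ≤ C₀ * Λ₀ ^ j * (j ! : ℝ) := by
      have hb : ∀ y, |iteratedFDeriv ℝ j f y fun _ => dir s i| ≤ C₀ * Λ₀ ^ j * (j ! : ℝ) :=
        fun y => (abs_iteratedFDeriv_le_absDeriv j f y s i).trans (ha y j)
      exact norm_coef_le hb k
    rw [h2, norm_mul, norm_pow, norm_mul, Complex.norm_I, mul_one, Complex.norm_real, phase_dir,
      Real.norm_eq_abs, abs_mul, abs_of_pos Real.two_pi_pos] at h3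
    exact h3
  -- Weighting the `j`-th bound by `1/((2Λ₀)^j j!)` turns the left sides into an exponential series
  -- and the right sides into a geometric one.
  have h4 : HasSum (fun j : ℕ => (t / (2 * Λ₀)) ^ j / (j ! : ℝ) * ‖coef f k‖)
      (Real.exp (t / (2 * Λ₀)) * ‖coef f k‖) := by
    exact (hasSum_pow_div_factorial (t / (2 * Λ₀))).mul_right _
  have h5 : HasSum (fun j : ℕ => C₀ * (1 / 2 : ℝ) ^ j) (C₀ * 2) := hasSum_geometric_two.mul_left _
  have h6 : Real.exp (t / (2 * Λ₀)) * ‖coef f k‖ ≤ C₀ * 2 := by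
    refine hasSum_le (fun j => ?_) h4 h5
    have h7 := h1 j
    have h8 : (t / (2 * Λ₀)) ^ j / (j ! : ℝ) * ‖coef f k‖
        = (t ^ j * ‖coef f k‖) * ((2 * Λ₀) ^ j * (j ! : ℝ))⁻¹ := by
      rw [div_pow]; field_simp
    have h9 : C₀ * (1 / 2 : ℝ) ^ j
        = (C₀ * Λ₀ ^ j * (j ! : ℝ)) * ((2 * Λ₀) ^ j * (j ! : ℝ))⁻¹ := by
      rw [mul_pow, div_pow, one_pow]; field_simp
    rw [h8, h9]
    exact mul_le_mul_of_nonneg_right h7 (by positivity)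
  have hnd : (0 : ℝ) < (n * d : ℕ) := by
    have := Fin.pos_iff_nonempty.mpr ‹Nonempty (Fin n)›
    have := Fin.pos_iff_nonempty.mpr ‹Nonempty (Fin d)›
    positivity
  have h10 : Real.pi / (Λ₀ * (n * d : ℕ)) * size k ≤ t / (2 * Λ₀) := by
    rw [ht]
    calc Real.pi / (Λ₀ * (n * d : ℕ)) * size k
        ≤ Real.pi / (Λ₀ * (n * d : ℕ)) * ((n * d : ℕ) * |(k s i : ℝ)|) := by gcongr
      _ = _ := by field_simp
  have hC : 0 ≤ C₀ := by
    have := (mul_nonneg (Real.exp_pos (t / (2 * Λ₀))).le (norm_nonneg (coef f k))).trans h6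
    linarith
  calc ‖coef f k‖ = Real.exp (-(t / (2 * Λ₀))) * (Real.exp (t / (2 * Λ₀)) * ‖coef f k‖) := by
        rw [← mul_assoc, ← Real.exp_add]; simp
    _ ≤ Real.exp (-(Real.pi / (Λ₀ * (n * d : ℕ)) * size k)) * (C₀ * 2) := by gcongr
    _ = _ := by ring

end Decay

/-! ### The linear system for the modes: weighted energy estimate and solvability -/

section ModeSystem

variable {d n : ℕ}

/-- The matrix of `-∇̂ · A ∇̂` in Fourier space, where `p` is the symbol of `-i∇̂` and `a` are the
Fourier coefficients of `A`. -/
noncomputable def kernel (p : Modes d n → Fin d → ℝ) (a : Fin d → Fin d → Modes d n → ℂ)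
    (k l : Modes d n) : ℂ := ∑ i, ∑ j, (p k i : ℂ) * a i j (k - l) * (p l j : ℂ)

/-- Ellipticity in Fourier space. -/
def Accretive (lam : ℝ) (a : Fin d → Fin d → Modes d n → ℂ) : Prop :=
  ∀ (S : Finset (Modes d n)) (Y : Modes d n → Fin d → ℂ),
    lam * ∑ k ∈ S, ∑ i, ‖Y k i‖ ^ 2
      ≤ (∑ k ∈ S, ∑ l ∈ S, ∑ i, ∑ j, conj (Y k i) * a i j (k - l) * Y l j).re

variable {p : Modes d n → Fin d → ℝ} {a : Fin d → Fin d → Modes d n → ℂ} {lam τ : ℝ}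

/-- Schur test for a convolution kernel: its row and column sums are all at most `∑ b`. -/
theorem schur_le {b : Modes d n → ℝ} (hb0 : ∀ m, 0 ≤ b m) (hb : Summable b)
    (S : Finset (Modes d n)) {N : Modes d n → ℝ} (hN : ∀ k, 0 ≤ N k) :
    ∑ k ∈ S, ∑ l ∈ S, b (k - l) * ((N k + N l) / 2) ≤ (∑' m, b m) * ∑ k ∈ S, N k := by
  have h1 : ∀ k, ∑ l ∈ S, b (k - l) ≤ ∑' m, b m := fun k => by
    rw [← (Equiv.subLeft k).tsum_eq b]
    exact ((Equiv.subLeft k).summable_iff.mpr hb).sum_le_tsum S fun l _ => hb0 _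
  have h2 : ∀ l, ∑ k ∈ S, b (k - l) ≤ ∑' m, b m := fun l => by
    rw [← (Equiv.subRight l).tsum_eq b]
    exact ((Equiv.subRight l).summable_iff.mpr hb).sum_le_tsum S fun l _ => hb0 _
  have h3 : ∑ k ∈ S, ∑ l ∈ S, b (k - l) * N k ≤ (∑' m, b m) * ∑ k ∈ S, N k := by
    rw [Finset.mul_sum]
    refine Finset.sum_le_sum fun k _ => ?_
    rw [← Finset.sum_mul]
    exact mul_le_mul_of_nonneg_right (h1 k) (hN k)
  have h4 : ∑ k ∈ S, ∑ l ∈ S, b (k - l) * N l ≤ (∑' m, b m) * ∑ k ∈ S, N k := by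
    rw [Finset.sum_comm, Finset.mul_sum]
    refine Finset.sum_le_sum fun l _ => ?_
    rw [← Finset.sum_mul]
    exact mul_le_mul_of_nonneg_right (h2 l) (hN l)
  have h5 : ∑ k ∈ S, ∑ l ∈ S, b (k - l) * ((N k + N l) / 2)
      = (∑ k ∈ S, ∑ l ∈ S, b (k - l) * N k + ∑ k ∈ S, ∑ l ∈ S, b (k - l) * N l) / 2 := by
    rw [← Finset.sum_add_distrib, Finset.sum_div]
    refine Finset.sum_congr rfl fun k _ => ?_
    rw [← Finset.sum_add_distrib, Finset.sum_div]
    refine Finset.sum_congr rfl fun l _ => ?_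
    ring
  rw [h5]
  linarith

/-- The weighted energy estimate for the truncated system. -/
theorem energy_le (hlam : 0 < lam) (hpos : Accretive lam a) (S : Finset (Modes d n))
    {w : Modes d n → ℝ} (hw : ∀ k, 0 < w k) {b : Modes d n → ℝ} (hb : Summable b)
    (hwb : ∀ k l, |w k / w l - 1| * ∑ i, ∑ j, ‖a i j (k - l)‖ ≤ b (k - l))
    (hb0 : ∀ m, 0 ≤ b m) (hB : ∑' m, b m ≤ lam / 2)
    {x : Modes d n → ℂ} {g : Modes d n → Fin d → ℂ}
    (hx : ∀ k ∈ S, ∑ l ∈ S, kernel p a k l * x l + (τ : ℂ) ^ 2 * x k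
      = Complex.I * ∑ i, (p k i : ℂ) * g k i) :
    lam / 4 * ∑ k ∈ S, ∑ i, (w k * |p k i| * ‖x k‖) ^ 2 + τ ^ 2 * ∑ k ∈ S, (w k * ‖x k‖) ^ 2
      ≤ 1 / lam * ∑ k ∈ S, ∑ i, (w k * ‖g k i‖) ^ 2 := by
  -- Equation `k` is tested with `w k ^ 2 * conj (x k)`. Up to a factor `i`, `Y` is the gradient of
  -- the weighted unknown.
  set Y : Modes d n → Fin d → ℂ := fun k i => (w k : ℂ) * (p k i : ℂ) * x k with hY
  set N : Modes d n → ℝ := fun k => ∑ i, ‖Y k i‖ ^ 2 with hN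
  have hN0 : ∀ k, 0 ≤ N k := fun k => Finset.sum_nonneg fun i _ => sq_nonneg _
  have hYN : ∀ k i, ‖Y k i‖ ^ 2 ≤ N k := fun k i =>
    Finset.single_le_sum (f := fun i => ‖Y k i‖ ^ 2) (fun i _ => sq_nonneg _) (Finset.mem_univ i)
  have hYn : ∀ k i, ‖Y k i‖ = w k * |p k i| * ‖x k‖ := fun k i => by
    simp [hY, abs_of_pos (hw k)]
  -- the commutator of the weight with the kernel
  set R : ℂ := ∑ k ∈ S, ∑ l ∈ S, ∑ i, ∑ j,
    ((w k / w l - 1 : ℝ) : ℂ) * (conj (Y k i) * a i j (k - l) * Y l j) with hR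
  have hRle : ‖R‖ ≤ lam / 2 * ∑ k ∈ S, N k := by
    refine le_trans ?_ ((schur_le hb0 hb S hN0).trans
      (mul_le_mul_of_nonneg_right hB (Finset.sum_nonneg fun k _ => hN0 k)))
    refine (norm_sum_le _ _).trans (Finset.sum_le_sum fun k _ => ?_)
    refine (norm_sum_le _ _).trans (Finset.sum_le_sum fun l _ => ?_)
    calc ‖∑ i, ∑ j, ((w k / w l - 1 : ℝ) : ℂ) * (conj (Y k i) * a i j (k - l) * Y l j)‖
        ≤ ∑ i, ∑ j, |w k / w l - 1| * ‖a i j (k - l)‖ * ((N k + N l) / 2) := by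
          refine (norm_sum_le _ _).trans (Finset.sum_le_sum fun i _ => ?_)
          refine (norm_sum_le _ _).trans (Finset.sum_le_sum fun j _ => ?_)
          rw [norm_mul, norm_mul, norm_mul, Complex.norm_real, Real.norm_eq_abs,
            RCLike.norm_conj]
          have h1 : ‖Y k i‖ * ‖Y l j‖ ≤ (N k + N l) / 2 := by
            have := hYN k i
            have := hYN l j
            nlinarith [sq_nonneg (‖Y k i‖ - ‖Y l j‖)]
          calc |w k / w l - 1| * (‖Y k i‖ * ‖a i j (k - l)‖ * ‖Y l j‖)
              = |w k / w l - 1| * ‖a i j (k - l)‖ * (‖Y k i‖ * ‖Y l j‖) := by ring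
            _ ≤ _ := mul_le_mul_of_nonneg_left h1 (by positivity)
      _ = (|w k / w l - 1| * ∑ i, ∑ j, ‖a i j (k - l)‖) * ((N k + N l) / 2) := by
          simp_rw [Finset.mul_sum, Finset.sum_mul]
      _ ≤ _ := mul_le_mul_of_nonneg_right (hwb k l) (by have := hN0 k; have := hN0 l; linarith)
  have h0 := hpos S Y
  set T : ℂ := ∑ k ∈ S, ∑ l ∈ S, ∑ i, ∑ j, conj (Y k i) * a i j (k - l) * Y l j with hT
  set F : ℂ := ∑ k ∈ S, ∑ i, Complex.I * (conj (Y k i) * ((w k : ℂ) * g k i)) with hF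
  -- Since `w k ^ 2 = w k * w l * (w k / w l)`, writing the quotient as `1 + (w k / w l - 1)` splits
  -- the form into the elliptic part `T` and the commutator `R`.
  have hid : T + R + ((τ ^ 2 * ∑ k ∈ S, (w k * ‖x k‖) ^ 2 : ℝ) : ℂ) = F := by
    have h1 : ∀ k ∈ S, (∑ l ∈ S, ∑ i, ∑ j, conj (Y k i) * a i j (k - l) * Y l j)
        + (∑ l ∈ S, ∑ i, ∑ j,
          ((w k / w l - 1 : ℝ) : ℂ) * (conj (Y k i) * a i j (k - l) * Y l j))
        + ((τ ^ 2 * (w k * ‖x k‖) ^ 2 : ℝ) : ℂ)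
        = ∑ i, Complex.I * (conj (Y k i) * ((w k : ℂ) * g k i)) := by
      intro k hk
      have h2 := congrArg (fun z => (w k : ℂ) ^ 2 * conj (x k) * z) (hx k hk)
      simp only [mul_add] at h2
      have h3 : (w k : ℂ) ^ 2 * conj (x k) * ((τ : ℂ) ^ 2 * x k)
          = ((τ ^ 2 * (w k * ‖x k‖) ^ 2 : ℝ) : ℂ) := by
        push_cast
        rw [mul_pow, ← Complex.conj_mul' (x k)]
        ring
      rw [h3] at h2
      have h4 : (w k : ℂ) ^ 2 * conj (x k) * (Complex.I * ∑ i, (p k i : ℂ) * g k i)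
          = ∑ i, Complex.I * (conj (Y k i) * ((w k : ℂ) * g k i)) := by
        simp only [Finset.mul_sum, hY, map_mul, Complex.conj_ofReal]
        refine Finset.sum_congr rfl fun i _ => ?_
        ring
      rw [h4] at h2
      rw [← h2, ← Finset.sum_add_distrib]
      congr 1
      rw [Finset.mul_sum]
      refine Finset.sum_congr rfl fun l _ => ?_
      rw [kernel, Finset.sum_mul, Finset.mul_sum, ← Finset.sum_add_distrib]
      refine Finset.sum_congr rfl fun i _ => ?_
      rw [Finset.sum_mul, Finset.mul_sum, ← Finset.sum_add_distrib]
      refine Finset.sum_congr rfl fun j _ => ?_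
      have hwl : (w l : ℂ) ≠ 0 := by exact_mod_cast (hw l).ne'
      simp only [hY, map_mul, Complex.conj_ofReal]
      push_cast
      field_simp
      ring
    have h2 := Finset.sum_congr rfl h1
    rw [Finset.sum_add_distrib, Finset.sum_add_distrib] at h2
    rw [hF, ← h2, hT, hR]
    push_cast
    rw [Finset.mul_sum]
  -- Young's inequality with weights `lam / 4` and `1 / lam`. After the `lam / 2` lost to `R`, a
  -- quarter of the ellipticity remains.
  have hFle : ‖F‖ ≤ lam / 4 * ∑ k ∈ S, N k + 1 / lam * ∑ k ∈ S, ∑ i, (w k * ‖g k i‖) ^ 2 := by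
    rw [Finset.mul_sum, Finset.mul_sum, ← Finset.sum_add_distrib]
    refine (norm_sum_le _ _).trans (Finset.sum_le_sum fun k _ => ?_)
    rw [hN, Finset.mul_sum, Finset.mul_sum, ← Finset.sum_add_distrib]
    refine (norm_sum_le _ _).trans (Finset.sum_le_sum fun i _ => ?_)
    rw [norm_mul, norm_mul, norm_mul, Complex.norm_I, one_mul, RCLike.norm_conj,
      Complex.norm_real, Real.norm_eq_abs, abs_of_pos (hw k)]
    have h1 : lam / 4 * ‖Y k i‖ ^ 2 + 1 / lam * (w k * ‖g k i‖) ^ 2 - ‖Y k i‖ * (w k * ‖g k i‖)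
        = 1 / lam * (lam / 2 * ‖Y k i‖ - w k * ‖g k i‖) ^ 2 := by
      field_simp
      ring
    have h2 : 0 ≤ 1 / lam * (lam / 2 * ‖Y k i‖ - w k * ‖g k i‖) ^ 2 := by positivity
    linarith
  have hre := congrArg Complex.re hid
  rw [Complex.add_re, Complex.add_re, Complex.ofReal_re] at hre
  have h1 := (abs_le.mp ((Complex.abs_re_le_norm R).trans hRle)).1
  have h2 := (le_abs_self _).trans ((Complex.abs_re_le_norm F).trans hFle)
  simp_rw [← hYn]
  change lam / 4 * ∑ k ∈ S, N k + _ ≤ _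
  change lam * ∑ k ∈ S, N k ≤ _ at h0
  linarith

/-- The truncated system is solvable. -/
theorem exists_truncated_solution (hlam : 0 < lam) (hτ : 0 < τ) (hpos : Accretive lam a)
    (S : Finset (Modes d n)) (g : Modes d n → Fin d → ℂ) :
    ∃ x : Modes d n → ℂ, (∀ k ∉ S, x k = 0) ∧
      ∀ k ∈ S, ∑ l ∈ S, kernel p a k l * x l + (τ : ℂ) ^ 2 * x k
        = Complex.I * ∑ i, (p k i : ℂ) * g k i := by
  classical
  let T : (S → ℂ) →ₗ[ℂ] (S → ℂ) :=
    (Matrix.of fun k l : S => kernel p a k l).mulVecLin + ((τ : ℂ) ^ 2) • LinearMap.id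
  let ext : (S → ℂ) → Modes d n → ℂ := fun x k => if h : k ∈ S then x ⟨k, h⟩ else 0
  have hext : ∀ x (k : S), ext x k = x k := fun x k => by simp [ext]
  have hT : ∀ x (k : S), T x k
      = ∑ l ∈ S, kernel p a k l * ext x l + (τ : ℂ) ^ 2 * ext x k := by
    intro x k
    rw [hext, ← Finset.sum_coe_sort S fun l => kernel p a k l * ext x l]
    simp [T, Matrix.mulVec, dotProduct, hext]
  have hinj : Function.Injective T := by
    rw [← LinearMap.ker_eq_bot, LinearMap.ker_eq_bot']
    intro x hx0
    -- With weight `1` there is no commutator, and with zero data the term in `τ ^ 2` forces `x =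
    -- 0`. In finite dimension injectivity gives surjectivity.
    have hE := energy_le (p := p) (τ := τ) (g := fun _ _ => 0) (x := ext x) (w := fun _ => 1)
      (b := fun _ => 0)
      hlam hpos S (fun _ => one_pos) summable_zero (by simp) (by simp)
      (by simp; positivity) (by
        intro k hk
        have := congrFun hx0 ⟨k, hk⟩
        rw [hT] at this
        simpa using this)
    simp only [norm_zero, mul_zero, ne_eq, OfNat.ofNat_ne_zero, not_false_eq_true, zero_pow,
      Finset.sum_const_zero, one_mul] at hE
    have h1 : 0 ≤ lam / 4 * ∑ k ∈ S, ∑ i, (|p k i| * ‖ext x k‖) ^ 2 := by positivity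
    have h2 : 0 ≤ ∑ k ∈ S, ‖ext x k‖ ^ 2 := by positivity
    have h3 : ∑ k ∈ S, ‖ext x k‖ ^ 2 = 0 := by
      have : 0 < τ ^ 2 := by positivity
      nlinarith
    rw [Finset.sum_eq_zero_iff_of_nonneg fun _ _ => sq_nonneg _] at h3
    ext k
    rw [← hext x k]
    simpa using h3 k k.2
  obtain ⟨x, hx⟩ := (LinearMap.injective_iff_surjective.mp hinj)
    fun k : S => Complex.I * ∑ i, (p k i : ℂ) * g k i
  refine ⟨ext x, fun k hk => by simp [ext, hk], fun k hk => ?_⟩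
  rw [← hT x ⟨k, hk⟩, hx]

/-- The full system has an exponentially decaying solution. -/
theorem exists_mode_solution (hlam : 0 < lam) (hτ : 0 < τ) (hpos : Accretive lam a)
    {Ca σ G : ℝ} (hσ : 0 < σ) (hCa : ∀ i j m, ‖a i j m‖ ≤ Ca)
    (hs : Summable fun m => (Real.exp (σ * size m) - 1) * ∑ i, ∑ j, ‖a i j m‖)
    (hB : ∑' m, (Real.exp (σ * size m) - 1) * ∑ i, ∑ j, ‖a i j m‖ ≤ lam / 2)
    {g : Modes d n → Fin d → ℂ}
    (hG : ∀ S : Finset (Modes d n), ∑ k ∈ S, ∑ i, (Real.exp (σ * size k) * ‖g k i‖) ^ 2 ≤ G) :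
    ∃ x : Modes d n → ℂ,
      (∀ k, ‖x k‖ ≤ √(G / (lam * τ ^ 2)) * Real.exp (-(σ * size k))) ∧
      (∀ k i, |p k i| * ‖x k‖ ≤ √(4 * G / lam ^ 2) * Real.exp (-(σ * size k))) ∧
      ∀ k, HasSum (fun l => kernel p a k l * x l)
        (Complex.I * (∑ i, (p k i : ℂ) * g k i) - (τ : ℂ) ^ 2 * x k) := by
  classical
  choose X hX0 hXeq using fun S => exists_truncated_solution (p := p) hlam hτ hpos S g
  set w : Modes d n → ℝ := fun k => Real.exp (σ * size k) with hw
  -- `|e^s - 1| ≤ e^r - 1` whenever `|s| ≤ r`; for negative `s` this rests on `2 ≤ e^r + e^(-r)`.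
  have hwb : ∀ k l, |w k / w l - 1| * ∑ i, ∑ j, ‖a i j (k - l)‖
      ≤ (Real.exp (σ * size (k - l)) - 1) * ∑ i, ∑ j, ‖a i j (k - l)‖ := by
    intro k l
    refine mul_le_mul_of_nonneg_right ?_ (by positivity)
    have h1 : w k / w l = Real.exp (σ * (size k - size l)) := by
      rw [hw, ← Real.exp_sub]; congr 1; ring
    have h2 : |size k - size l| ≤ size (k - l) := by
      rw [abs_le]
      have h3 := size_le_sub_add k l
      have h4 := size_le_sub_add l k
      rw [← neg_sub k l, size_neg] at h4
      constructor <;> linarith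
    have h5 : |σ * (size k - size l)| ≤ σ * size (k - l) := by
      rw [abs_mul, abs_of_pos hσ]
      exact mul_le_mul_of_nonneg_left h2 hσ.le
    rw [h1, abs_le]
    set t := σ * (size k - size l)
    set r := σ * size (k - l)
    obtain ⟨h6, h7⟩ := abs_le.mp h5
    refine ⟨?_, sub_le_sub_right (Real.exp_le_exp.mpr h7) 1⟩
    have h8 := Real.exp_le_exp.mpr h6
    have h9 : 2 ≤ Real.exp r + Real.exp (-r) := by
      have := Real.add_one_le_exp r
      have := Real.add_one_le_exp (-r)
      linarith
    linarith
  have hwpos : ∀ k, 0 < w k := fun k => Real.exp_pos _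
  have hE := fun S => energy_le hlam hpos S hwpos hs hwb
    (fun m => mul_nonneg (sub_nonneg.mpr (Real.one_le_exp (mul_nonneg hσ.le (size_nonneg m))))
      (by positivity)) hB (hXeq S)
  have hE2 : ∀ S, lam / 4 * ∑ k ∈ S, ∑ i, (w k * |p k i| * ‖X S k‖) ^ 2
      + τ ^ 2 * ∑ k ∈ S, (w k * ‖X S k‖) ^ 2 ≤ 1 / lam * G := fun S =>
    (hE S).trans (mul_le_mul_of_nonneg_left (hG S) (by positivity))
  have hG0 : 0 ≤ G := by simpa using hG ∅
  have hwinv : ∀ k, Real.exp (-(σ * size k)) = (w k)⁻¹ := fun k => Real.exp_neg _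
  -- Read off from the mass term, hence dependent on `τ`; it serves compactness and smoothness only.
  have hb1 : ∀ S k, ‖X S k‖ ≤ √(G / (lam * τ ^ 2)) * Real.exp (-(σ * size k)) := by
    intro S k
    rw [hwinv, ← div_eq_mul_inv, le_div_iff₀ (hwpos k)]
    by_cases hk : k ∈ S
    · apply Real.le_sqrt_of_sq_le
      have h1 : (w k * ‖X S k‖) ^ 2 ≤ ∑ k ∈ S, (w k * ‖X S k‖) ^ 2 :=
        Finset.single_le_sum (f := fun k => (w k * ‖X S k‖) ^ 2) (fun _ _ => sq_nonneg _) hk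
      have h2 : 0 ≤ lam / 4 * ∑ k ∈ S, ∑ i, (w k * |p k i| * ‖X S k‖) ^ 2 := by positivity
      have h3 : τ ^ 2 * (w k * ‖X S k‖) ^ 2 ≤ 1 / lam * G :=
        (mul_le_mul_of_nonneg_left h1 (sq_nonneg τ)).trans (by linarith [hE2 S])
      rw [le_div_iff₀ (by positivity), mul_comm ‖X S k‖]
      calc _ = lam * (τ ^ 2 * (w k * ‖X S k‖) ^ 2) := by ring
        _ ≤ lam * (1 / lam * G) := mul_le_mul_of_nonneg_left h3 hlam.le
        _ = G := by field_simp
    · rw [hX0 S k hk]; simp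
  -- Read off from the gradient term, hence free of `τ`. The uniform estimates come from this bound.
  have hb2 : ∀ S k i, |p k i| * ‖X S k‖ ≤ √(4 * G / lam ^ 2) * Real.exp (-(σ * size k)) := by
    intro S k i
    rw [hwinv, ← div_eq_mul_inv, le_div_iff₀ (hwpos k)]
    by_cases hk : k ∈ S
    · apply Real.le_sqrt_of_sq_le
      have h0 : (w k * |p k i| * ‖X S k‖) ^ 2 ≤ ∑ i, (w k * |p k i| * ‖X S k‖) ^ 2 :=
        Finset.single_le_sum (f := fun i => (w k * |p k i| * ‖X S k‖) ^ 2)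
          (fun _ _ => sq_nonneg _) (Finset.mem_univ i)
      have h1 : ∑ i, (w k * |p k i| * ‖X S k‖) ^ 2
          ≤ ∑ k ∈ S, ∑ i, (w k * |p k i| * ‖X S k‖) ^ 2 :=
        Finset.single_le_sum (f := fun k => ∑ i, (w k * |p k i| * ‖X S k‖) ^ 2)
          (fun _ _ => by positivity) hk
      have h2 : 0 ≤ τ ^ 2 * ∑ k ∈ S, (w k * ‖X S k‖) ^ 2 := by positivity
      have h3 : lam / 4 * (w k * |p k i| * ‖X S k‖) ^ 2 ≤ 1 / lam * G :=
        (mul_le_mul_of_nonneg_left (h0.trans h1) (by positivity)).trans (by linarith [hE2 S])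
      rw [le_div_iff₀ (by positivity)]
      calc _ = 4 * lam * (lam / 4 * (w k * |p k i| * ‖X S k‖) ^ 2) := by ring
        _ ≤ 4 * lam * (1 / lam * G) := mul_le_mul_of_nonneg_left h3 (by positivity)
        _ = 4 * G := by field_simp
    · rw [hX0 S k hk]; simp
  -- pass to the limit along an ultrafilter
  let 𝓤 : Ultrafilter (Finset (Modes d n)) := Ultrafilter.of Filter.atTop
  have h𝓤 : (𝓤 : Filter (Finset (Modes d n))) ≤ Filter.atTop := Ultrafilter.of_le _
  have hlim : ∀ k, ∃ z, Filter.Tendsto (fun S => X S k) 𝓤 (nhds z) := by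
    intro k
    obtain ⟨z, -, hz⟩ := (isCompact_closedBall (0 : ℂ)
      (√(G / (lam * τ ^ 2)) * Real.exp (-(σ * size k)))).ultrafilter_le_nhds
      (𝓤.map fun S => X S k) (by
        rw [Filter.le_principal_iff]
        exact Filter.mem_map.mpr (Filter.univ_mem' fun S => by simpa using hb1 S k))
    exact ⟨z, hz⟩
  choose x hx using hlim
  refine ⟨x, fun k => le_of_tendsto (hx k).norm (Filter.Eventually.of_forall fun S => hb1 S k),
    fun k i => le_of_tendsto ((hx k).norm.const_mul _)
      (Filter.Eventually.of_forall fun S => hb2 S k i), fun k => ?_⟩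
  set D : ℝ := (∑ i, ∑ _j : Fin d, |p k i| * Ca) * √(4 * G / lam ^ 2) with hD
  -- The unbounded factor `p l` is paired with `X S l` and controlled by `hb2`, which gives a
  -- summable majorant independent of `S`.
  have hdom : ∀ S l, ‖kernel p a k l * X S l‖ ≤ D * Real.exp (-(σ * size l)) := by
    intro S l
    rw [norm_mul, kernel]
    calc ‖∑ i, ∑ j, (p k i : ℂ) * a i j (k - l) * (p l j : ℂ)‖ * ‖X S l‖
        ≤ (∑ i, ∑ j, |p k i| * ‖a i j (k - l)‖ * |p l j|) * ‖X S l‖ := by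
          refine mul_le_mul_of_nonneg_right ?_ (norm_nonneg _)
          refine (norm_sum_le _ _).trans (Finset.sum_le_sum fun i _ => ?_)
          refine (norm_sum_le _ _).trans (Finset.sum_le_sum fun j _ => ?_)
          simp
      _ = ∑ i, ∑ j, |p k i| * ‖a i j (k - l)‖ * (|p l j| * ‖X S l‖) := by
          rw [Finset.sum_mul]
          refine Finset.sum_congr rfl fun i _ => ?_
          rw [Finset.sum_mul]
          refine Finset.sum_congr rfl fun j _ => by ring
      _ ≤ ∑ i, ∑ _j : Fin d,
          |p k i| * Ca * (√(4 * G / lam ^ 2) * Real.exp (-(σ * size l))) := by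
          refine Finset.sum_le_sum fun i _ => Finset.sum_le_sum fun j _ => ?_
          refine mul_le_mul ?_ (hb2 S l j) (by positivity) ?_
          · exact mul_le_mul_of_nonneg_left (hCa i j _) (abs_nonneg _)
          · exact mul_nonneg (abs_nonneg _) ((norm_nonneg _).trans (hCa i j 0))
      _ = D * Real.exp (-(σ * size l)) := by
          simp_rw [hD, ← Finset.sum_mul]
          ring
  have hsum := (summable_exp_size (d := d) (n := n) hσ).mul_left D
  have ht := tendsto_tsum_of_dominated_convergence (𝓕 := (𝓤 : Filter (Finset (Modes d n))))
    (f := fun S l => kernel p a k l * X S l) (g := fun l => kernel p a k l * x l) hsum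
    (fun l => (hx l).const_mul _) (Filter.Eventually.of_forall fun S l => hdom S l)
  have hx_sum : Summable fun l => kernel p a k l * x l :=
    Summable.of_norm_bounded hsum fun l => le_of_tendsto ((hx l).const_mul _).norm
      (Filter.Eventually.of_forall fun S => hdom S l)
  -- As soon as `k ∈ S` the `k`-th truncated equation holds, and the terms with `l ∉ S` vanish.
  have ht2 : Filter.Tendsto (fun S => ∑' l, kernel p a k l * X S l) 𝓤
      (nhds (Complex.I * (∑ i, (p k i : ℂ) * g k i) - (τ : ℂ) ^ 2 * x k)) := by
    refine Filter.Tendsto.congr' ?_ (((hx k).const_mul ((τ : ℂ) ^ 2)).const_sub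
      (Complex.I * (∑ i, (p k i : ℂ) * g k i)))
    have hk : ∀ᶠ S in (𝓤 : Filter (Finset (Modes d n))), k ∈ S :=
      h𝓤 (Filter.eventually_ge_atTop {k} |>.mono fun S hS => hS (Finset.mem_singleton_self k))
    filter_upwards [hk] with S hS
    rw [tsum_eq_sum (s := S) fun l hl => by rw [hX0 S l hl, mul_zero], ← hXeq S k hS]
    ring
  rw [← tendsto_nhds_unique ht ht2]
  exact hx_sum.hasSum

/-- For a real problem the solution may be taken hermitian. -/
theorem exists_hermitian_mode_solution (hlam : 0 < lam) (hτ : 0 < τ) (hpos : Accretive lam a)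
    {Ca σ G : ℝ} (hσ : 0 < σ) (hCa : ∀ i j m, ‖a i j m‖ ≤ Ca)
    (hs : Summable fun m => (Real.exp (σ * size m) - 1) * ∑ i, ∑ j, ‖a i j m‖)
    (hB : ∑' m, (Real.exp (σ * size m) - 1) * ∑ i, ∑ j, ‖a i j m‖ ≤ lam / 2)
    {g : Modes d n → Fin d → ℂ}
    (hG : ∀ S : Finset (Modes d n), ∑ k ∈ S, ∑ i, (Real.exp (σ * size k) * ‖g k i‖) ^ 2 ≤ G)
    (hp : ∀ k i, p (-k) i = - p k i) (ha : ∀ i j m, a i j (-m) = conj (a i j m))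
    (hg : ∀ k i, g (-k) i = conj (g k i)) :
    ∃ x : Modes d n → ℂ, (∀ k, x (-k) = conj (x k)) ∧
      (∀ k, ‖x k‖ ≤ √(G / (lam * τ ^ 2)) * Real.exp (-(σ * size k))) ∧
      (∀ k i, |p k i| * ‖x k‖ ≤ √(4 * G / lam ^ 2) * Real.exp (-(σ * size k))) ∧
      ∀ k, HasSum (fun l => kernel p a k l * x l)
        (Complex.I * (∑ i, (p k i : ℂ) * g k i) - (τ : ℂ) ^ 2 * x k) := by
  obtain ⟨x, h1, h2, h3⟩ := exists_mode_solution (p := p) hlam hτ hpos hσ hCa hs hB hG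
  have hn : ∀ k, ‖(x k + conj (x (-k))) / 2‖ ≤ (‖x k‖ + ‖x (-k)‖) / 2 := fun k => by
    rw [norm_div, Complex.norm_ofNat]
    refine div_le_div_of_nonneg_right ?_ two_pos.le
    simpa using norm_add_le (x k) (conj (x (-k)))
  -- The reflection `k ↦ conj (x (-k))` solves the same system and obeys the same bounds, so the
  -- average with it does too.
  refine ⟨fun k => (x k + conj (x (-k))) / 2, fun k => ?_, fun k => ?_, fun k i => ?_,
    fun k => ?_⟩
  · beta_reduce
    rw [map_div₀, map_add, Complex.conj_conj, neg_neg, map_ofNat, add_comm]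
  · have h4 := h1 (-k)
    rw [size_neg] at h4
    linarith [hn k, h1 k]
  · have h4 := h2 (-k) i
    rw [size_neg, hp, abs_neg] at h4
    have := mul_le_mul_of_nonneg_left (hn k) (abs_nonneg (p k i))
    linarith [h2 k i]
  · have h4 : HasSum (fun l => kernel p a k l * conj (x (-l)))
        (Complex.I * (∑ i, (p k i : ℂ) * g k i) - (τ : ℂ) ^ 2 * conj (x (-k))) := by
      have h5 := Complex.hasSum_conj'.mpr (h3 (-k))
      rw [← (Equiv.neg (Modes d n)).hasSum_iff] at h5
      convert h5 using 1
      · ext l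
        simp only [Function.comp, Equiv.neg_apply, map_mul, kernel, map_sum, hp]
        congr 1
        refine Finset.sum_congr rfl fun i _ => Finset.sum_congr rfl fun j _ => ?_
        rw [show -k - -l = -(k - l) by abel, ha]
        simp
      · simp only [map_sub, map_mul, map_sum, hp, hg, Complex.conj_I, map_pow,
          Complex.conj_ofReal, Complex.conj_conj]
        simp
    have h6 := ((h3 k).add h4).div_const 2
    have h7 : HasSum (fun l => kernel p a k l * ((x l + conj (x (-l))) / 2))
        (Complex.I * (∑ i, (p k i : ℂ) * g k i) - (τ : ℂ) ^ 2 * ((x k + conj (x (-k))) / 2)) := by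
      have h8 : (fun l => kernel p a k l * ((x l + conj (x (-l))) / 2))
          = fun l => (kernel p a k l * x l + kernel p a k l * conj (x (-l))) / 2 := by
        ext l; ring
      have h9 : Complex.I * (∑ i, (p k i : ℂ) * g k i)
            - (τ : ℂ) ^ 2 * ((x k + conj (x (-k))) / 2)
          = (Complex.I * (∑ i, (p k i : ℂ) * g k i) - (τ : ℂ) ^ 2 * x k
            + (Complex.I * (∑ i, (p k i : ℂ) * g k i) - (τ : ℂ) ^ 2 * conj (x (-k)))) / 2 := by
        ring
      rw [h8, h9]
      exact h6
    exact h7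

end ModeSystem

/-! ### Smooth periodic functions -/

/-- Smooth functions on the torus. -/
structure IsSmoothPeriodic {d n : ℕ} (f : Vars d n → ℝ) : Prop where
  smooth : ContDiff ℝ ∞ f
  periodic : IsCellPeriodic f

namespace IsSmoothPeriodic

variable {d n : ℕ} {f g : Vars d n → ℝ}

theorem continuous (hf : IsSmoothPeriodic f) : Continuous f := hf.smooth.continuous

theorem differentiable (hf : IsSmoothPeriodic f) : Differentiable ℝ f :=
  hf.smooth.differentiable (by simp)

theorem const (c : ℝ) : IsSmoothPeriodic fun _ : Vars d n => c :=
  ⟨contDiff_const, fun _ _ => rfl⟩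

theorem add (hf : IsSmoothPeriodic f) (hg : IsSmoothPeriodic g) :
    IsSmoothPeriodic fun y => f y + g y :=
  ⟨hf.smooth.add hg.smooth, fun y z => by rw [hf.periodic y z, hg.periodic y z]⟩

theorem mul (hf : IsSmoothPeriodic f) (hg : IsSmoothPeriodic g) :
    IsSmoothPeriodic fun y => f y * g y :=
  ⟨hf.smooth.mul hg.smooth, fun y z => by rw [hf.periodic y z, hg.periodic y z]⟩

theorem neg (hf : IsSmoothPeriodic f) : IsSmoothPeriodic fun y => - f y :=
  ⟨hf.smooth.neg, fun y z => by rw [hf.periodic y z]⟩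

theorem sub (hf : IsSmoothPeriodic f) (hg : IsSmoothPeriodic g) :
    IsSmoothPeriodic fun y => f y - g y := by
  simpa only [sub_eq_add_neg] using hf.add hg.neg

theorem sum {ι : Type*} (s : Finset ι) {f : ι → Vars d n → ℝ}
    (hf : ∀ i, IsSmoothPeriodic (f i)) : IsSmoothPeriodic fun y => ∑ i ∈ s, f i y :=
  ⟨ContDiff.sum fun i _ => (hf i).smooth, fun y z =>
    Finset.sum_congr rfl fun i _ => (hf i).periodic y z⟩

theorem hatD (δ : Fin n → ℝ) (i : Fin d) (hf : IsSmoothPeriodic f) :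
    IsSmoothPeriodic (hatD δ i f) := by
  have h : ∀ k, IsSmoothPeriodic fun y => fderiv ℝ f y (dir k i) := fun k =>
    ⟨(hf.smooth.fderiv_right (m := ∞) (by simp)).clm_apply contDiff_const, fun y z => by rw [hf.periodic.fderiv y z]⟩
  exact sum _ fun k => (const _).mul (h k)

theorem hatDiv (δ : Fin n → ℝ) {F : Vars d n → Fin d → ℝ}
    (hF : ∀ i, IsSmoothPeriodic fun y => F y i) : IsSmoothPeriodic (hatDiv δ F) :=
  sum _ fun i => (hF i).hatD δ i

theorem mulVec {A : Vars d n → Matrix (Fin d) (Fin d) ℝ}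
    (hA : ∀ i j, IsSmoothPeriodic fun y => A y i j) {F : Vars d n → Fin d → ℝ}
    (hF : ∀ i, IsSmoothPeriodic fun y => F y i) (i : Fin d) :
    IsSmoothPeriodic fun y => (A y *ᵥ F y) i :=
  sum Finset.univ fun j => (hA i j).mul (hF j)

end IsSmoothPeriodic

/-! ### The operator `∇̂_n` in Fourier space -/

section Symbol

variable {d n : ℕ}

/-- The symbol of `-i∇̂_n`. -/
noncomputable def symb (δ : Fin n → ℝ) (k : Modes d n) (i : Fin d) : ℝ :=
  2 * Real.pi * ∑ s, (δ s)⁻¹ * k s i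

theorem symb_neg (δ : Fin n → ℝ) (k : Modes d n) (i : Fin d) :
    symb δ (-k) i = - symb δ k i := by
  simp [symb]

theorem symb_zero (δ : Fin n → ℝ) (i : Fin d) : symb δ (0 : Modes d n) i = 0 := by
  simp [symb]

theorem coef_hatD {f : Vars d n → ℝ} (δ : Fin n → ℝ) (hf : IsSmoothPeriodic f) (i : Fin d)
    (k : Modes d n) : coef (hatD δ i f) k = Complex.I * symb δ k i * coef f k := by
  have hc : ∀ s, Continuous fun y => (δ s)⁻¹ * fderiv ℝ f y (dir s i) := fun s =>
    continuous_const.mul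
      ((hf.smooth.continuous_fderiv (by simp)).clm_apply continuous_const)
  change coef (fun y => ∑ s, (δ s)⁻¹ * fderiv ℝ f y (dir s i)) k = _
  rw [coef_sum _ hc]
  simp_rw [coef_const_mul, coef_fderiv hf.periodic (hf.smooth.of_le (by simp)), phase_dir]
  rw [symb]
  push_cast
  rw [Finset.mul_sum, Finset.mul_sum, Finset.sum_mul]
  refine Finset.sum_congr rfl fun s _ => ?_
  ring

theorem coef_hatDiv (δ : Fin n → ℝ) {F : Vars d n → Fin d → ℝ}
    (hF : ∀ i, IsSmoothPeriodic fun y => F y i) (k : Modes d n) :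
    coef (hatDiv δ F) k = ∑ i, Complex.I * symb δ k i * coef (fun y => F y i) k := by
  change coef (fun y => ∑ i, hatD δ i (fun y' => F y' i) y) k = _
  rw [coef_sum _ fun i => ((hF i).hatD δ i).continuous]
  exact Finset.sum_congr rfl fun i _ => coef_hatD δ (hF i) i k

theorem eq_zero_of_coef {f : Vars d n → ℝ} (hf : IsSmoothPeriodic f) (h : ∀ k, coef f k = 0)
    (y : Vars d n) : f y = 0 := by
  have h0 : coef f = 0 := funext h
  have h1 := hasSum_coef hf.continuous hf.periodic (by rw [h0]; exact summable_zero) y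
  simp only [h, zero_mul] at h1
  exact_mod_cast h1.unique hasSum_zero

theorem eq_of_coef {f g : Vars d n → ℝ} (hf : IsSmoothPeriodic f) (hg : IsSmoothPeriodic g)
    (h : ∀ k, coef f k = coef g k) (y : Vars d n) : f y = g y := by
  have := eq_zero_of_coef (hf.sub hg)
    (fun k => by rw [coef_sub hf.continuous hg.continuous, h, sub_self]) y
  linarith

theorem isSmoothPeriodic_synth {x : Modes d n → ℂ} {M σ : ℝ} (hσ : 0 < σ)
    (hx : ∀ k, ‖x k‖ ≤ M * Real.exp (-(σ * size k))) : IsSmoothPeriodic (synth x) :=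
  ⟨contDiff_synth hσ hx, isCellPeriodic_synth x⟩

end Symbol

/-! ### Uniqueness of correctors and flux potentials -/

section Uniqueness

variable {d n : ℕ} {δ : Fin n → ℝ} {τ : ℝ} {A : Vars d n → Matrix (Fin d) (Fin d) ℝ}

theorem cellAverage_hatDiv {F : Vars d n → Fin d → ℝ}
    (hF : ∀ i, IsSmoothPeriodic fun y => F y i) : cellAverage (hatDiv δ F) = 0 := by
  have h := coef_hatDiv δ hF 0
  rw [coef_zero_index] at h
  simp only [symb_zero, Complex.ofReal_zero, mul_zero, zero_mul, Finset.sum_const_zero] at h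
  exact_mod_cast h

theorem hatD_mul {f g : Vars d n → ℝ} (hf : IsSmoothPeriodic f) (hg : IsSmoothPeriodic g)
    (i : Fin d) (y : Vars d n) :
    hatD δ i (fun y => f y * g y) y = f y * hatD δ i g y + hatD δ i f y * g y := by
  simp only [hatD, Finset.mul_sum, Finset.sum_mul, ← Finset.sum_add_distrib]
  refine Finset.sum_congr rfl fun k _ => ?_
  rw [fderiv_fun_mul (hf.differentiable y) (hg.differentiable y)]
  simp
  ring

theorem hatD_sub {f g : Vars d n → ℝ} (hf : IsSmoothPeriodic f) (hg : IsSmoothPeriodic g)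
    (i : Fin d) (y : Vars d n) :
    hatD δ i (fun y => f y - g y) y = hatD δ i f y - hatD δ i g y := by
  simp only [hatD, ← Finset.sum_sub_distrib]
  refine Finset.sum_congr rfl fun k _ => ?_
  rw [fderiv_fun_sub (hf.differentiable y) (hg.differentiable y)]
  simp
  ring

/-- Multiplying by `Z` and averaging gives `τ²⟨Z²⟩ + ⟨∇̂Z · A∇̂Z⟩ = 0`, because `∇̂ · (Z A∇̂Z)` has
mean zero. The mass term alone forces `Z = 0`, so the degeneracy of `∇̂` does no harm. -/
theorem eq_zero_of_homogeneous (hτ : 0 < τ) (hA : ∀ i j, IsSmoothPeriodic fun y => A y i j)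
    (hpos : ∀ y (ξ : Fin d → ℝ), 0 ≤ ξ ⬝ᵥ (A y *ᵥ ξ)) {Z : Vars d n → ℝ}
    (hZ : IsSmoothPeriodic Z)
    (heq : ∀ y, -hatDiv δ (fun y' => A y' *ᵥ hatGrad δ Z y') y + τ ^ 2 * Z y = 0) :
    ∀ y, Z y = 0 := by
  have hF := IsSmoothPeriodic.mulVec hA (F := hatGrad δ Z) fun i => hZ.hatD δ i
  have hZF : ∀ i, IsSmoothPeriodic fun y => Z y * (A y *ᵥ hatGrad δ Z y) i :=
    fun i => hZ.mul (hF i)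
  have h1 := cellAverage_hatDiv (δ := δ) (F := fun y i => Z y * (A y *ᵥ hatGrad δ Z y) i) hZF
  have h2 : ∀ y, hatDiv δ (fun y i => Z y * (A y *ᵥ hatGrad δ Z y) i) y
      = τ ^ 2 * (Z y * Z y) + hatGrad δ Z y ⬝ᵥ (A y *ᵥ hatGrad δ Z y) := by
    intro y
    have h3 : hatDiv δ (fun y i => Z y * (A y *ᵥ hatGrad δ Z y) i) y
        = Z y * hatDiv δ (fun y' => A y' *ᵥ hatGrad δ Z y') y
          + hatGrad δ Z y ⬝ᵥ (A y *ᵥ hatGrad δ Z y) := by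
      simp only [hatDiv, Finset.mul_sum, dotProduct, ← Finset.sum_add_distrib]
      exact Finset.sum_congr rfl fun i _ => hatD_mul hZ (hF i) i y
    rw [h3]
    linear_combination (-(Z y)) * heq y
  have hZZ := hZ.mul hZ
  have hle : ∫ y in Set.Icc (0 : Vars d n) 1, τ ^ 2 * (Z y * Z y) ≤ 0 := by
    rw [← h1]
    refine integral_mono (integrable_cell (continuous_const.mul hZZ.continuous))
      (integrable_cell (IsSmoothPeriodic.hatDiv δ hZF).continuous) fun y => ?_
    beta_reduce
    rw [h2]
    linarith [hpos y (hatGrad δ Z y)]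
  rw [integral_const_mul] at hle
  have h0 : ∫ y in Set.Icc (0 : Vars d n) 1, Z y * Z y = 0 := by
    have : 0 ≤ ∫ y in Set.Icc (0 : Vars d n) 1, Z y * Z y :=
      integral_nonneg fun y => mul_self_nonneg _
    have : 0 < τ ^ 2 := by positivity
    nlinarith
  rw [integral_eq_zero_iff_of_nonneg (fun y => mul_self_nonneg _)
    (integrable_cell hZZ.continuous)] at h0
  refine eq_zero_of_coef hZ fun k => ?_
  rw [coef, integral_eq_zero_of_ae]
  filter_upwards [h0] with y hy
  rw [mul_self_eq_zero.mp hy]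
  simp

theorem IsCorrector.isSmoothPeriodic {v : Fin d → ℝ} {X : Vars d n → ℝ}
    (h : IsCorrector δ τ A v X) : IsSmoothPeriodic X := ⟨h.smooth, h.periodic⟩

theorem IsFluxPotential.isSmoothPeriodic {X : Fin d → Vars d n → ℝ} {i j : Fin d}
    {U : Vars d n → ℝ} (h : IsFluxPotential δ τ A X i j U) : IsSmoothPeriodic U :=
  ⟨h.smooth, h.periodic⟩

/-- The right-hand side is arbitrary, so that with the identity matrix for `A` this also covers the
flux potentials. -/
theorem sub_solution (hA : ∀ i j, IsSmoothPeriodic fun y => A y i j) {X X' : Vars d n → ℝ}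
    (hX : IsSmoothPeriodic X) (hX' : IsSmoothPeriodic X') {f : Vars d n → ℝ}
    (h : ∀ y, -hatDiv δ (fun y' => A y' *ᵥ hatGrad δ X y') y + τ ^ 2 * X y = f y)
    (h' : ∀ y, -hatDiv δ (fun y' => A y' *ᵥ hatGrad δ X' y') y + τ ^ 2 * X' y = f y)
    (y : Vars d n) :
    -hatDiv δ (fun y' => A y' *ᵥ hatGrad δ (fun y => X y - X' y) y') y
      + τ ^ 2 * (X y - X' y) = 0 := by
  have h1 : (fun y' => A y' *ᵥ hatGrad δ (fun y => X y - X' y) y')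
      = fun y' i => (A y' *ᵥ hatGrad δ X y') i - (A y' *ᵥ hatGrad δ X' y') i := by
    ext y' i
    have : hatGrad δ (fun y => X y - X' y) y' = hatGrad δ X y' - hatGrad δ X' y' :=
      funext fun i => hatD_sub hX hX' i y'
    rw [this, Matrix.mulVec_sub, Pi.sub_apply]
  have h2 : hatDiv δ (fun y' i => (A y' *ᵥ hatGrad δ X y') i - (A y' *ᵥ hatGrad δ X' y') i) y
      = hatDiv δ (fun y' => A y' *ᵥ hatGrad δ X y') y
        - hatDiv δ (fun y' => A y' *ᵥ hatGrad δ X' y') y := by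
    simp only [hatDiv, ← Finset.sum_sub_distrib]
    exact Finset.sum_congr rfl fun i _ => hatD_sub
      (IsSmoothPeriodic.mulVec hA (F := hatGrad δ X) (fun i => hX.hatD δ i) i)
      (IsSmoothPeriodic.mulVec hA (F := hatGrad δ X') (fun i => hX'.hatD δ i) i) i y
  rw [h1, h2]
  linear_combination h y - h' y

theorem IsCorrector.unique (hτ : 0 < τ) (hA : ∀ i j, IsSmoothPeriodic fun y => A y i j)
    (hpos : ∀ y (ξ : Fin d → ℝ), 0 ≤ ξ ⬝ᵥ (A y *ᵥ ξ)) {v : Fin d → ℝ} {X X' : Vars d n → ℝ}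
    (h : IsCorrector δ τ A v X) (h' : IsCorrector δ τ A v X') : X = X' := by
  have hX := h.isSmoothPeriodic
  have hX' := h'.isSmoothPeriodic
  ext y
  exact sub_eq_zero.mp (eq_zero_of_homogeneous hτ hA hpos (hX.sub hX')
    (sub_solution hA hX hX' h.equation h'.equation) y)

theorem IsFluxPotential.unique (hτ : 0 < τ) {X : Fin d → Vars d n → ℝ} {i j : Fin d}
    {U U' : Vars d n → ℝ} (h : IsFluxPotential δ τ A X i j U)
    (h' : IsFluxPotential δ τ A X i j U') : U = U' := by
  have hU := h.isSmoothPeriodic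
  have hU' := h'.isSmoothPeriodic
  have hone : ∀ i j, IsSmoothPeriodic fun _ : Vars d n => (1 : Matrix (Fin d) (Fin d) ℝ) i j :=
    fun i j => IsSmoothPeriodic.const _
  ext y
  refine sub_eq_zero.mp (eq_zero_of_homogeneous (δ := δ) hτ hone (fun y ξ => ?_) (hU.sub hU')
    (sub_solution hone hU hU' (f := fun y => effective δ A X i j - flux δ A X y i j) ?_ ?_) y)
  · rw [Matrix.one_mulVec]
    exact Finset.sum_nonneg fun i _ => mul_self_nonneg _
  · simpa only [Matrix.one_mulVec] using h.equation
  · simpa only [Matrix.one_mulVec] using h'.equation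

end Uniqueness

/-! ### From mode systems to solutions on the torus -/

section Existence

variable {d n : ℕ} {δ : Fin n → ℝ} {τ : ℝ} {A : Vars d n → Matrix (Fin d) (Fin d) ℝ}

/-- The double sum is the cell integral of `F̄ · A F` for the trigonometric polynomial `F` with
coefficients `Y`. Pointwise, its real part is the quadratic form of `A` at `Re F` plus that at `Im
F`, even if `A` is not symmetric. -/
theorem accretive_coef {lam : ℝ} (hA : ∀ i j, Continuous fun y => A y i j)
    (hell : ∀ y (ξ : Fin d → ℝ), lam * (ξ ⬝ᵥ ξ) ≤ ξ ⬝ᵥ (A y *ᵥ ξ)) :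
    Accretive lam fun i j => coef fun y => A y i j := by
  intro S Y
  let F : Fin d → Vars d n → ℂ := fun i y => ∑ k ∈ S, Y k i * wave k y
  have hFc : ∀ i, Continuous (F i) := fun i =>
    continuous_finsetSum _ fun k _ => continuous_const.mul (continuous_wave k)
  have hAc : ∀ i j, Continuous fun y => (A y i j : ℂ) := fun i j =>
    Complex.continuous_ofReal.comp (hA i j)
  have hterm : ∀ i j, Continuous fun y => conj (F i y) * A y i j * F j y := fun i j =>
    ((Complex.continuous_conj.comp (hFc i)).mul (hAc i j)).mul (hFc j)
  have hterm1 : ∀ i, Continuous fun y => conj (F i y) * ((1 : ℝ) : ℂ) * F i y := fun i =>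
    ((Complex.continuous_conj.comp (hFc i)).mul continuous_const).mul (hFc i)
  have hexp : ∀ (g : Vars d n → ℝ), Continuous g → ∀ i j,
      ∫ y in Set.Icc (0 : Vars d n) 1, conj (F i y) * g y * F j y
        = ∑ k ∈ S, ∑ l ∈ S, conj (Y k i) * coef g (k - l) * Y l j := by
    intro g hg i j
    have h1 : ∀ y, conj (F i y) * g y * F j y
        = ∑ k ∈ S, ∑ l ∈ S, conj (Y k i) * Y l j * (g y * wave (-(k - l)) y) := by
      intro y
      simp only [F, map_sum, map_mul, Finset.sum_mul, Finset.mul_sum]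
      refine Finset.sum_comm.trans (Finset.sum_congr rfl fun k _ => Finset.sum_congr rfl
        fun l _ => ?_)
      rw [neg_sub, sub_eq_add_neg, wave_add, wave_neg]
      ring
    simp_rw [h1]
    rw [integral_finsetSum _ fun k _ => integrable_finsetSum _ fun l _ =>
      (integrable_cell (continuous_coef_integrand hg (k - l))).const_mul _]
    refine Finset.sum_congr rfl fun k _ => ?_
    rw [integral_finsetSum _ fun l _ =>
      (integrable_cell (continuous_coef_integrand hg (k - l))).const_mul _]
    refine Finset.sum_congr rfl fun l _ => ?_
    rw [integral_const_mul, coef]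
    ring
  have h1 : ∑ k ∈ S, ∑ l ∈ S, ∑ i, ∑ j, conj (Y k i) * coef (fun y => A y i j) (k - l) * Y l j
      = ∫ y in Set.Icc (0 : Vars d n) 1, ∑ i, ∑ j, conj (F i y) * A y i j * F j y := by
    rw [integral_finsetSum _ fun i _ => integrable_cell
      (continuous_finsetSum _ fun j _ => hterm i j)]
    simp_rw [integral_finsetSum _ fun j _ => integrable_cell (hterm _ j), hexp _ (hA _ _)]
    simp_rw [Finset.sum_comm (s := S) (t := Finset.univ)]
  have h2 : ((∑ k ∈ S, ∑ i, ‖Y k i‖ ^ 2 : ℝ) : ℂ)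
      = ∫ y in Set.Icc (0 : Vars d n) 1, ∑ i, conj (F i y) * ((1 : ℝ) : ℂ) * F i y := by
    rw [integral_finsetSum _ fun i _ => integrable_cell (hterm1 i)]
    simp_rw [hexp (fun _ => 1) continuous_const, coef_const, sub_eq_zero]
    rw [Finset.sum_comm]
    push_cast
    refine Finset.sum_congr rfl fun i _ => Finset.sum_congr rfl fun k hk => ?_
    simp [hk, Complex.conj_mul']
  have hint1 : Integrable (fun y => ∑ i, ∑ j, conj (F i y) * A y i j * F j y)
      (volume.restrict (Set.Icc (0 : Vars d n) 1)) :=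
    integrable_cell (continuous_finsetSum _ fun i _ => continuous_finsetSum _ fun j _ =>
      hterm i j)
  have hint2 : Integrable (fun y => ∑ i, conj (F i y) * ((1 : ℝ) : ℂ) * F i y)
      (volume.restrict (Set.Icc (0 : Vars d n) 1)) :=
    integrable_cell (continuous_finsetSum _ fun i _ => hterm1 i)
  have h2' := congrArg Complex.re h2
  rw [Complex.ofReal_re] at h2'
  rw [h1, h2', ← Complex.reCLM_apply, ← Complex.reCLM_apply,
    ← ContinuousLinearMap.integral_comp_comm _ hint1,
    ← ContinuousLinearMap.integral_comp_comm _ hint2, ← integral_const_mul]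
  refine integral_mono ((Complex.reCLM.integrable_comp hint2).const_mul _)
    (Complex.reCLM.integrable_comp hint1) fun y => ?_
  have h3 := hell y fun i => (F i y).re
  have h4 := hell y fun i => (F i y).im
  simp only [dotProduct, Matrix.mulVec, Finset.mul_sum] at h3 h4
  simp only [Complex.reCLM_apply, Complex.re_sum, Finset.mul_sum]
  refine le_trans (le_of_eq ?_) ((add_le_add h3 h4).trans (le_of_eq ?_))
  · rw [← Finset.sum_add_distrib]
    refine Finset.sum_congr rfl fun i _ => ?_
    simp
    ring
  · rw [← Finset.sum_add_distrib]
    refine Finset.sum_congr rfl fun i _ => ?_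
    rw [← Finset.sum_add_distrib]
    refine Finset.sum_congr rfl fun j _ => ?_
    simp
    ring

/-- The bound `hpx` makes the coefficients of `∇̂X` summable, so those of `A∇̂X` are convolutions
and the mode system is the equation compared coefficient by coefficient. -/
theorem isCorrector_synth (hA : ∀ i j, IsSmoothPeriodic fun y => A y i j) {v : Fin d → ℝ}
    {x : Modes d n → ℂ} {M M' σ : ℝ} (hσ : 0 < σ) (hh : ∀ k, x (-k) = conj (x k))
    (hx : ∀ k, ‖x k‖ ≤ M * Real.exp (-(σ * size k)))
    (hpx : ∀ k i, |symb δ k i| * ‖x k‖ ≤ M' * Real.exp (-(σ * size k)))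
    (heq : ∀ k, HasSum (fun l => kernel (symb δ) (fun i j => coef fun y => A y i j) k l * x l)
      (Complex.I * (∑ i, (symb δ k i : ℂ) * coef (fun y => (A y *ᵥ v) i) k)
        - (τ : ℂ) ^ 2 * x k)) :
    IsCorrector δ τ A v (synth x) := by
  have hX := isSmoothPeriodic_synth hσ hx
  have hcX : ∀ k, coef (synth x) k = x k := coef_synth (summable_norm_of_decay hσ hx) hh
  refine ⟨hX.smooth, hX.periodic, ?_⟩
  have hF := IsSmoothPeriodic.mulVec hA (F := hatGrad δ (synth x)) fun i => hX.hatD δ i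
  have hv := IsSmoothPeriodic.mulVec hA (F := fun _ => v) fun i => IsSmoothPeriodic.const _
  have hD : ∀ j, Summable fun k => ‖coef (hatD δ j (synth x)) k‖ := fun j => by
    refine summable_norm_of_decay (M := M') hσ fun k => ?_
    rw [coef_hatD δ hX, hcX]
    simpa using hpx k j
  have hL := IsSmoothPeriodic.hatDiv δ hF
  have hR := IsSmoothPeriodic.hatDiv δ hv
  have hτX : IsSmoothPeriodic fun y => τ ^ 2 * synth x y := (IsSmoothPeriodic.const _).mul hX
  refine eq_of_coef (hL.neg.add hτX) hR fun k => ?_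
  rw [coef_add hL.neg.continuous hτX.continuous, coef_neg_fun, coef_const_mul, hcX,
    coef_hatDiv δ hF, coef_hatDiv δ hv]
  have h1 : ∀ i, coef (fun y => (A y *ᵥ hatGrad δ (synth x) y) i) k
      = ∑ j, coef (fun y => A y i j * hatD δ j (synth x) y) k := fun i =>
    coef_sum Finset.univ (fun j => ((hA i j).mul (hX.hatD δ j)).continuous) k
  have h2 : ∀ i j, HasSum (fun l => coef (fun y => A y i j) (k - l)
      * (Complex.I * symb δ l j * x l)) (coef (fun y => A y i j * hatD δ j (synth x) y) k) := by
    intro i j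
    have := hasSum_coef_mul (hA i j).continuous (hD j)
      (hasSum_coef (hX.hatD δ j).continuous (hX.hatD δ j).periodic (hD j).of_norm) k
    simpa only [coef_hatD δ hX, hcX] using this
  have h3 : HasSum (fun l => ∑ i, Complex.I * symb δ k i * ∑ j, coef (fun y => A y i j) (k - l)
      * (Complex.I * symb δ l j * x l))
      (∑ i, Complex.I * symb δ k i * coef (fun y => (A y *ᵥ hatGrad δ (synth x) y) i) k) := by
    simp_rw [h1]
    exact hasSum_sum fun i _ => (hasSum_sum fun j _ => h2 i j).mul_left _
  have h4 : (fun l => ∑ i, Complex.I * symb δ k i * ∑ j, coef (fun y => A y i j) (k - l)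
      * (Complex.I * symb δ l j * x l))
      = fun l => -(kernel (symb δ) (fun i j => coef fun y => A y i j) k l * x l) := by
    ext l
    rw [kernel, Finset.sum_mul, ← Finset.sum_neg_distrib]
    refine Finset.sum_congr rfl fun i _ => ?_
    rw [Finset.mul_sum, Finset.sum_mul, ← Finset.sum_neg_distrib]
    refine Finset.sum_congr rfl fun j _ => ?_
    linear_combination ((symb δ k i : ℂ) * coef (fun y => A y i j) (k - l) * symb δ l j * x l)
      * Complex.I_mul_I
  rw [h4] at h3
  rw [h3.unique (heq k).neg]
  simp only [Finset.mul_sum, mul_assoc]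
  push_cast
  ring

theorem coef_potential {U f : Vars d n → ℝ} (hU : IsSmoothPeriodic U)
    (h : ∀ y, -hatDiv δ (hatGrad δ U) y + τ ^ 2 * U y = f y) (k : Modes d n) :
    ((∑ i, symb δ k i ^ 2 + τ ^ 2 : ℝ) : ℂ) * coef U k = coef f k := by
  have hG : ∀ i, IsSmoothPeriodic fun y => hatGrad δ U y i := fun i => hU.hatD δ i
  have hL := IsSmoothPeriodic.hatDiv δ hG
  have hτU : IsSmoothPeriodic fun y => τ ^ 2 * U y := (IsSmoothPeriodic.const _).mul hU
  rw [← show _ = f from funext h, coef_add hL.neg.continuous hτU.continuous, coef_neg_fun,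
    coef_const_mul, coef_hatDiv δ hG]
  have h1 : ∀ i, coef (fun y => hatGrad δ U y i) k = Complex.I * symb δ k i * coef U k :=
    fun i => coef_hatD δ hU i k
  simp_rw [h1]
  push_cast
  rw [add_mul, Finset.sum_mul, ← Finset.sum_neg_distrib]
  congr 1
  refine Finset.sum_congr rfl fun i _ => ?_
  linear_combination ((symb δ k i : ℂ) ^ 2 * coef U k) * Complex.I_mul_I

/-- The operator is the multiplier `|p_k|² + τ²`. It is real, even in `k` and at least `τ²`, so
dividing by it preserves symmetry and decay. -/
theorem exists_potential (hτ : 0 < τ) {f : Vars d n → ℝ} (hf : IsSmoothPeriodic f) {M σ : ℝ}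
    (hσ : 0 < σ) (hM : ∀ k, ‖coef f k‖ ≤ M * Real.exp (-(σ * size k))) :
    ∃ U, IsSmoothPeriodic U ∧ ∀ y, -hatDiv δ (hatGrad δ U) y + τ ^ 2 * U y = f y := by
  set x : Modes d n → ℂ := fun k => coef f k / ((∑ i, symb δ k i ^ 2 + τ ^ 2 : ℝ) : ℂ) with hx
  have hpos : ∀ k : Modes d n, τ ^ 2 ≤ ∑ i, symb δ k i ^ 2 + τ ^ 2 := fun k =>
    le_add_of_nonneg_left (Finset.sum_nonneg fun _ _ => sq_nonneg _)
  have hτ2 : 0 < τ ^ 2 := by positivity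
  have hxd : ∀ k, ‖x k‖ ≤ (M / τ ^ 2) * Real.exp (-(σ * size k)) := fun k => by
    rw [hx, norm_div, Complex.norm_real, Real.norm_eq_abs, abs_of_pos (hτ2.trans_le (hpos k)),
      div_mul_eq_mul_div]
    exact div_le_div₀ ((norm_nonneg _).trans (hM k)) (hM k) hτ2 (hpos k)
  have hh : ∀ k, x (-k) = conj (x k) := fun k => by
    simp [hx, coef_neg, symb_neg, map_div₀]
  have hU := isSmoothPeriodic_synth hσ hxd
  have hG : ∀ i, IsSmoothPeriodic fun y => hatGrad δ (synth x) y i := fun i => hU.hatD δ i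
  have hτU : IsSmoothPeriodic fun y => τ ^ 2 * synth x y := (IsSmoothPeriodic.const _).mul hU
  refine ⟨synth x, hU, eq_of_coef ((IsSmoothPeriodic.hatDiv δ hG).neg.add hτU) hf fun k => ?_⟩
  rw [← coef_potential (δ := δ) (τ := τ) hU (fun _ => rfl) k,
    coef_synth (summable_norm_of_decay hσ hxd) hh]
  refine mul_div_cancel₀ _ ?_
  exact_mod_cast (hτ2.trans_le (hpos k)).ne'

end Existence

/-! ### Decay of correctors and fluxes, uniform in the scales -/

section UniformBounds

variable {d n : ℕ}

/-- For a small rate the exponentially weighted commutator has small kernel. -/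
theorem exists_rate {σ₀ lam C₀ : ℝ} (hσ₀ : 0 < σ₀) (hlam : 0 < lam) (hC₀ : 0 ≤ C₀) :
    ∃ σ, 0 < σ ∧ σ ≤ σ₀ / 4 ∧ ∀ α : Modes d n → ℝ, (∀ m, 0 ≤ α m) →
      (∀ m, α m ≤ C₀ * Real.exp (-(σ₀ * size m))) →
      (Summable fun m => (Real.exp (σ * size m) - 1) * α m) ∧
      ∑' m, (Real.exp (σ * size m) - 1) * α m ≤ lam / 2 := by
  have hT_sum := summable_exp_size (d := d) (n := n) (half_pos hσ₀)
  set T := ∑' m : Modes d n, Real.exp (-(σ₀ / 2 * size m)) with hT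
  have hT0 : 0 ≤ T := tsum_nonneg fun _ => (Real.exp_pos _).le
  set B := 4 / σ₀ * C₀ * T with hB
  have hB0 : 0 ≤ B := by positivity
  -- From `e^s - 1 ≤ s e^s` with `s = σ|m|`: the weight and the linear factor `|m|` each cost at
  -- most `exp(σ₀|m|/4)`, leaving half the decay to sum. The total is at most `σ * B`, and the
  -- second bound on `σ` makes this at most `lam / 2`.
  refine ⟨min (σ₀ / 4) (lam / (2 * (B + 1))), lt_min (by positivity) (by positivity),
    min_le_left _ _, fun α hα0 hα => ?_⟩
  set σ := min (σ₀ / 4) (lam / (2 * (B + 1))) with hσ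
  have hσ0 : 0 < σ := lt_min (by positivity) (by positivity)
  have hσ1 : σ ≤ σ₀ / 4 := min_le_left _ _
  have hσ2 : σ * B ≤ lam / 2 := by
    have h1 : σ ≤ lam / (2 * (B + 1)) := min_le_right _ _
    rw [le_div_iff₀ (by positivity)] at h1
    nlinarith
  have hle : ∀ m, (Real.exp (σ * size m) - 1) * α m
      ≤ σ * (4 / σ₀) * C₀ * Real.exp (-(σ₀ / 2 * size m)) := by
    intro m
    have ht := size_nonneg m
    set t := size m
    have h1 : Real.exp (σ * t) - 1 ≤ σ * t * Real.exp (σ * t) := by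
      have h2 := Real.add_one_le_exp (-(σ * t))
      have h3 : Real.exp (σ * t) * Real.exp (-(σ * t)) = 1 := by rw [← Real.exp_add]; simp
      nlinarith [mul_le_mul_of_nonneg_left h2 (Real.exp_pos (σ * t)).le]
    have h4 : t ≤ 4 / σ₀ * Real.exp (σ₀ / 4 * t) := by
      have h5 := Real.add_one_le_exp (σ₀ / 4 * t)
      calc t = 4 / σ₀ * (σ₀ / 4 * t) := by field_simp
        _ ≤ _ := mul_le_mul_of_nonneg_left (by linarith) (by positivity)
    have h6 : Real.exp (σ * t) ≤ Real.exp (σ₀ / 4 * t) :=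
      Real.exp_le_exp.mpr (mul_le_mul_of_nonneg_right hσ1 ht)
    calc (Real.exp (σ * t) - 1) * α m
        ≤ (σ * (4 / σ₀ * Real.exp (σ₀ / 4 * t)) * Real.exp (σ₀ / 4 * t))
          * (C₀ * Real.exp (-(σ₀ * t))) := by
          refine mul_le_mul (h1.trans ?_) (hα m) (hα0 m) (by positivity)
          exact mul_le_mul (mul_le_mul_of_nonneg_left h4 hσ0.le) h6 (Real.exp_pos _).le
            (by positivity)
      _ = σ * (4 / σ₀) * C₀ * (Real.exp (σ₀ / 4 * t) * Real.exp (σ₀ / 4 * t)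
          * Real.exp (-(σ₀ * t))) := by ring
      _ = _ := by
          rw [← Real.exp_add, ← Real.exp_add]
          congr 2
          ring
  have h0 : ∀ m, 0 ≤ (Real.exp (σ * size m) - 1) * α m := fun m =>
    mul_nonneg (sub_nonneg.mpr (Real.one_le_exp (mul_nonneg hσ0.le (size_nonneg m)))) (hα0 m)
  have hs := Summable.of_nonneg_of_le h0 hle (hT_sum.mul_left _)
  refine ⟨hs, (hs.tsum_le_tsum hle (hT_sum.mul_left _)).trans ?_⟩
  rw [tsum_mul_left, ← hT]
  calc σ * (4 / σ₀) * C₀ * T = σ * B := by rw [hB]; ring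
    _ ≤ _ := hσ2

/-- Existence of the correctors, with exponential decay of the Fourier coefficients of the
corrector and of the flux which is uniform in the scales. -/
theorem exists_corrector [Nonempty (Fin n)] [Nonempty (Fin d)] {lam C₀ Λ₀ : ℝ} (hlam : 0 < lam)
    (hC₀ : 0 < C₀) (hΛ₀ : 0 < Λ₀) :
    ∃ σ M : ℝ, 0 < σ ∧ 0 ≤ M ∧ ∀ (A : Vars d n → Matrix (Fin d) (Fin d) ℝ) (δ : Fin n → ℝ) (τ : ℝ),
      0 < τ → (∀ i j, IsSmoothPeriodic fun y => A y i j) →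
      (∀ y (ξ : Fin d → ℝ), lam * (ξ ⬝ᵥ ξ) ≤ ξ ⬝ᵥ (A y *ᵥ ξ)) →
      (∀ i j y (ℓ : ℕ), absDeriv ℓ (fun y' => A y' i j) y ≤ C₀ * Λ₀ ^ ℓ * (ℓ ! : ℝ)) →
      ∃ X : Fin d → Vars d n → ℝ, ∀ j, IsCorrector δ τ A (Pi.single j 1) (X j) ∧
        (∀ k i, |symb δ k i| * ‖coef (X j) k‖ ≤ M * Real.exp (-(σ * size k))) ∧
        ∀ i k, ‖coef (fun y => flux δ A X y i j) k‖ ≤ M * Real.exp (-(σ * size k)) := by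
  have hnd : (0 : ℝ) < (n * d : ℕ) := by
    have := Fin.pos_iff_nonempty.mpr ‹Nonempty (Fin n)›
    have := Fin.pos_iff_nonempty.mpr ‹Nonempty (Fin d)›
    positivity
  set σ₀ : ℝ := Real.pi / (Λ₀ * (n * d : ℕ)) with hσ₀def
  have hσ₀ : 0 < σ₀ := by have := Real.pi_pos; positivity
  obtain ⟨σ, hσ, hσσ₀, hrate⟩ := exists_rate (d := d) (n := n) hσ₀ hlam
    (C₀ := ∑ _i : Fin d, ∑ _j : Fin d, 2 * C₀) (by positivity)
  have hT_sum := summable_exp_size (d := d) (n := n) (half_pos hσ₀)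
  set T := ∑' m : Modes d n, Real.exp (-(σ₀ / 2 * size m)) with hT
  have hT0 : 0 ≤ T := tsum_nonneg fun _ => (Real.exp_pos _).le
  -- `G` bounds the weighted norm of the data `A e_j`, `M₁` the coefficients of the gradient and
  -- `M₂` those of the flux. None involves `δ` or `τ`.
  set G : ℝ := d * (2 * C₀) ^ 2 * T with hG
  set M₁ : ℝ := √(4 * G / lam ^ 2) with hM₁
  have hM₁0 : 0 ≤ M₁ := Real.sqrt_nonneg _
  set M₂ : ℝ := 2 * C₀ + ∑ _j : Fin d, 2 * C₀ * M₁ * T with hM₂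
  have hM₂0 : 0 ≤ M₂ := by positivity
  refine ⟨σ, M₁ + M₂, hσ, by positivity, fun A δ τ hτ hA hell han => ?_⟩
  have ha : ∀ i j k, ‖coef (fun y => A y i j) k‖ ≤ 2 * C₀ * Real.exp (-(σ₀ * size k)) :=
    fun i j k => norm_coef_le_exp hΛ₀ (hA i j).periodic (hA i j).smooth (han i j) k
  have hexp1 : ∀ k : Modes d n, Real.exp (-(σ₀ * size k)) ≤ 1 := fun k =>
    Real.exp_le_one_iff.mpr (neg_nonpos.mpr (mul_nonneg hσ₀.le (size_nonneg k)))
  obtain ⟨hs, hB⟩ := hrate (fun m => ∑ i, ∑ j, ‖coef (fun y => A y i j) m‖)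
    (fun m => by positivity) (fun m => by
      rw [Finset.sum_mul]
      refine Finset.sum_le_sum fun i _ => ?_
      rw [Finset.sum_mul]
      exact Finset.sum_le_sum fun j _ => ha i j m)
  have hmode : ∀ j, ∃ X, IsCorrector δ τ A (Pi.single j 1) X ∧
      ∀ k i, |symb δ k i| * ‖coef X k‖ ≤ M₁ * Real.exp (-(σ * size k)) := by
    intro j
    have hcol : ∀ i, (fun y => (A y *ᵥ Pi.single j 1) i) = fun y => A y i j := fun i => by
      ext y; simp
    obtain ⟨x, hh, hx, hpx, hsum⟩ := exists_hermitian_mode_solution (p := symb δ)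
      (a := fun i j => coef fun y => A y i j) (g := fun k i => coef (fun y => A y i j) k) (G := G)
      hlam hτ (accretive_coef (fun i j => (hA i j).continuous) hell) hσ (Ca := 2 * C₀)
      (fun i j m => (ha i j m).trans (mul_le_of_le_one_right (by positivity) (hexp1 m))) hs hB
      (fun S => by
        have h1 : ∀ k i, (Real.exp (σ * size k) * ‖coef (fun y => A y i j) k‖) ^ 2
            ≤ (2 * C₀) ^ 2 * Real.exp (-(σ₀ / 2 * size k)) := by
          intro k i
          have ht := size_nonneg k
          calc (Real.exp (σ * size k) * ‖coef (fun y => A y i j) k‖) ^ 2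
              ≤ (Real.exp (σ * size k) * (2 * C₀ * Real.exp (-(σ₀ * size k)))) ^ 2 := by
                have := ha i j k
                gcongr
            _ = (2 * C₀) ^ 2 * (Real.exp (σ * size k) * Real.exp (-(σ₀ * size k))) ^ 2 := by ring
            _ ≤ _ := by
                rw [← Real.exp_add, ← Real.exp_nat_mul]
                refine mul_le_mul_of_nonneg_left (Real.exp_le_exp.mpr ?_) (by positivity)
                push_cast
                nlinarith [mul_le_mul_of_nonneg_right hσσ₀ ht, mul_nonneg hσ₀.le ht]
        calc ∑ k ∈ S, ∑ i, (Real.exp (σ * size k) * ‖coef (fun y => A y i j) k‖) ^ 2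
            ≤ ∑ k ∈ S, ∑ _i : Fin d, (2 * C₀) ^ 2 * Real.exp (-(σ₀ / 2 * size k)) :=
              Finset.sum_le_sum fun k _ => Finset.sum_le_sum fun i _ => h1 k i
          _ = d * (2 * C₀) ^ 2 * ∑ k ∈ S, Real.exp (-(σ₀ / 2 * size k)) := by
              rw [Finset.mul_sum]
              refine Finset.sum_congr rfl fun k _ => ?_
              simp
              ring
          _ ≤ G := mul_le_mul_of_nonneg_left (hT_sum.sum_le_tsum S fun _ _ => (Real.exp_pos _).le)
              (by positivity))
      (symb_neg δ) (fun i j m => coef_neg _ m) (fun k i => coef_neg _ k)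
    refine ⟨synth x, isCorrector_synth hA hσ hh hx hpx (fun k => ?_), fun k i => ?_⟩
    · simp_rw [hcol]
      exact hsum k
    · rw [coef_synth (summable_norm_of_decay hσ hx) hh]
      exact hpx k i
  choose X hX hpX using hmode
  refine ⟨X, fun j => ⟨hX j, fun k i => (hpX j k i).trans ?_, fun i k => ?_⟩⟩
  · gcongr
    linarith
  have hXs := (hX j).isSmoothPeriodic
  have hdec : ∀ i k, ‖coef (hatD δ i (X j)) k‖ ≤ M₁ * Real.exp (-(σ * size k)) := fun i k => by
    rw [coef_hatD δ hXs]
    simpa using hpX j k i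
  -- Convolving decay at rate `σ₀` with decay at rate `σ ≤ σ₀ / 4` keeps the rate `σ`, with
  -- `exp(-σ₀|k-l|/2)` left over for the summation in `l`.
  have hprod : ∀ i', ‖coef (fun y => A y i i' * hatD δ i' (X j) y) k‖
      ≤ 2 * C₀ * M₁ * T * Real.exp (-(σ * size k)) := by
    intro i'
    have hsD := summable_norm_of_decay hσ (hdec i')
    have h1 := hasSum_coef_mul (hA i i').continuous hsD
      (hasSum_coef (hXs.hatD δ i').continuous (hXs.hatD δ i').periodic hsD.of_norm) k
    have h2 : ∀ l, ‖coef (fun y => A y i i') (k - l) * coef (hatD δ i' (X j)) l‖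
        ≤ 2 * C₀ * M₁ * Real.exp (-(σ * size k)) * Real.exp (-(σ₀ / 2 * size (k - l))) := by
      intro l
      rw [norm_mul]
      calc _ ≤ (2 * C₀ * Real.exp (-(σ₀ * size (k - l)))) * (M₁ * Real.exp (-(σ * size l))) :=
            mul_le_mul (ha i i' _) (hdec i' l) (norm_nonneg _) (by positivity)
        _ = 2 * C₀ * M₁ * (Real.exp (-(σ₀ * size (k - l))) * Real.exp (-(σ * size l))) := by ring
        _ ≤ 2 * C₀ * M₁
            * (Real.exp (-(σ * size k)) * Real.exp (-(σ₀ / 2 * size (k - l)))) := by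
            rw [← Real.exp_add, ← Real.exp_add]
            refine mul_le_mul_of_nonneg_left (Real.exp_le_exp.mpr ?_) (by positivity)
            have h3 := mul_le_mul_of_nonneg_left (size_le_sub_add k l) hσ.le
            have h4 := mul_le_mul_of_nonneg_right hσσ₀ (size_nonneg (k - l))
            nlinarith [mul_nonneg hσ₀.le (size_nonneg (k - l))]
        _ = _ := by ring
    have h3 : HasSum (fun l => Real.exp (-(σ₀ / 2 * size (k - l)))) T :=
      (Equiv.subLeft k).hasSum_iff.mpr hT_sum.hasSum
    have h4 := h3.mul_left (2 * C₀ * M₁ * Real.exp (-(σ * size k)))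
    have h5 := h1.norm_le_of_bounded h4 h2
    calc _ ≤ _ := h5
      _ = _ := by ring
  have hcont : ∀ i', Continuous fun y => A y i i' * hatD δ i' (X j) y := fun i' =>
    ((hA i i').mul (hXs.hatD δ i')).continuous
  have hflux : coef (fun y => flux δ A X y i j) k = coef (fun y => A y i j) k
      + ∑ i', coef (fun y => A y i i' * hatD δ i' (X j) y) k := by
    rw [← coef_sum _ hcont]
    exact coef_add (hA i j).continuous (continuous_finsetSum _ fun i' _ => hcont i') k
  have hσle : Real.exp (-(σ₀ * size k)) ≤ Real.exp (-(σ * size k)) := by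
    refine Real.exp_le_exp.mpr (neg_le_neg (mul_le_mul_of_nonneg_right ?_ (size_nonneg k)))
    linarith
  calc ‖coef (fun y => flux δ A X y i j) k‖
      ≤ 2 * C₀ * Real.exp (-(σ * size k))
        + ∑ _i' : Fin d, 2 * C₀ * M₁ * T * Real.exp (-(σ * size k)) := by
        rw [hflux]
        refine (norm_add_le _ _).trans (add_le_add ((ha i j k).trans ?_) ?_)
        · gcongr
        · exact (norm_sum_le _ _).trans (Finset.sum_le_sum fun i' _ => hprod i')
    _ = M₂ * Real.exp (-(σ * size k)) := by
        rw [hM₂, add_mul, Finset.sum_mul]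
    _ ≤ _ := by
        gcongr
        linarith

end UniformBounds

/-! ### Small divisors and resonant modes -/

section Resonance

variable {d m : ℕ}

theorem resonance_le_one (hm : 1 ≤ m) {κ : ℝ} (hκ : 0 < κ) {ε : Fin (m + 1) → ℝ}
    (hε : ∀ k, 0 < ε k) : resonance κ ε ≤ 1 := by
  have : Nonempty (Fin m) := ⟨⟨0, hm⟩⟩
  refine ciSup_le fun j => Real.exp_le_one_iff.mpr (neg_nonpos.mpr ?_)
  exact mul_nonneg hκ.le (div_pos (hε _) (hε _)).le

theorem exp_le_resonance (κ : ℝ) (ε : Fin (m + 1) → ℝ) (j : Fin m) :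
    Real.exp (-(κ * (ε j.castSucc / ε j.succ))) ≤ resonance κ ε :=
  le_ciSup (f := fun j : Fin m => Real.exp (-(κ * (ε j.castSucc / ε j.succ))))
    (Set.finite_range _).bddAbove j

/-- The small divisors: away from high frequencies the symbol is bounded below. -/
theorem one_le_symb_or {ε δ : Fin (m + 1) → ℝ} (hε : ∀ k, 0 < ε k)
    (hanti : StrictAnti ε) (hδ : ∀ k, δ k = ε k / ε 0) {k : Modes d (m + 1)} (hk : k ≠ 0) :
    1 ≤ ∑ i, symb δ k i ^ 2 ∨
      ∃ j : Fin m, 1 / (2 * (m + 1 : ℝ)) * (ε j.castSucc / ε j.succ) ≤ size k := by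
  by_cases hres : ∃ j : Fin m, 1 / (2 * (m + 1 : ℝ)) * (ε j.castSucc / ε j.succ) ≤ size k
  · exact Or.inr hres
  left
  push Not at hres
  have hδ0 : ∀ s, 0 < δ s := fun s => by rw [hδ]; exact div_pos (hε s) (hε 0)
  -- `s` is the finest scale present in `k`; its term in the symbol is at least `(δ s)⁻¹`.
  obtain ⟨s, i, hsi, hmax⟩ : ∃ s i, k s i ≠ 0 ∧ ∀ s', s < s' → k s' = 0 := by
    obtain ⟨s₀, hs₀⟩ := Function.ne_iff.mp hk
    let S := Finset.univ.filter fun s => k s ≠ 0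
    have hS : S.Nonempty := ⟨s₀, by simpa [S] using hs₀⟩
    have h1 : k (S.max' hS) ≠ 0 := by simpa [S] using S.max'_mem hS
    obtain ⟨i, hi⟩ := Function.ne_iff.mp h1
    refine ⟨S.max' hS, i, hi, fun s' hs' => ?_⟩
    by_contra h
    exact absurd (S.le_max' s' (by simp [S, h])) (not_le.mpr hs')
  have hle_size : ∀ s', |(k s' i : ℝ)| ≤ size k := fun s' =>
    (Finset.single_le_sum (f := fun i => |(k s' i : ℝ)|) (fun _ _ => abs_nonneg _)
      (Finset.mem_univ i)).trans
    (Finset.single_le_sum (f := fun s' => ∑ i, |(k s' i : ℝ)|)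
      (fun _ _ => Finset.sum_nonneg fun _ _ => abs_nonneg _) (Finset.mem_univ s'))
  -- Without resonance, `|k s' i|` is at most `ε s' / ε (s'+1)` divided by `2(m+1)`. Hence each
  -- coarser scale contributes at most that fraction of `(δ s)⁻¹`; finer scales contribute nothing.
  have hother : ∀ s', s' ≠ s → |(δ s')⁻¹ * k s' i| ≤ 1 / (2 * (m + 1 : ℝ)) * (δ s)⁻¹ := by
    intro s' hs'
    rcases lt_or_gt_of_ne hs' with h | h
    · have hlt : (s' : ℕ) < m := by
        have h1 : (s' : ℕ) < s := h
        have h2 := s.isLt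
        omega
      set t : Fin m := ⟨s', hlt⟩ with ht
      have hcast : t.castSucc = s' := by ext; rfl
      have hsucc : t.succ ≤ s := by
        rw [Fin.le_def]
        exact h
      have h1 := (hle_size s').trans (hres t).le
      rw [hcast] at h1
      have h2 : ε s ≤ ε t.succ := hanti.antitone hsucc
      have e1 : (δ s')⁻¹ = ε 0 / ε s' := by rw [hδ, inv_div]
      have e2 : (δ s)⁻¹ = ε 0 / ε s := by rw [hδ, inv_div]
      rw [abs_mul, abs_of_pos (inv_pos.mpr (hδ0 s')), e1, e2]
      have p0 := hε 0
      have p1 := hε s'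
      have p2 := hε s
      have p3 := hε t.succ
      calc ε 0 / ε s' * |(k s' i : ℝ)|
          ≤ ε 0 / ε s' * (1 / (2 * (m + 1 : ℝ)) * (ε s' / ε t.succ)) := by gcongr
        _ = 1 / (2 * (m + 1 : ℝ)) * (ε 0 / ε t.succ) := by field_simp
        _ ≤ _ := by gcongr
    · rw [hmax s' h]
      have := (inv_pos.mpr (hδ0 s)).le
      simp only [Pi.zero_apply, Int.cast_zero, mul_zero, abs_zero]
      positivity
  have hδs : 1 ≤ (δ s)⁻¹ := by
    rw [hδ, inv_div, le_div_iff₀ (hε s), one_mul]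
    exact hanti.antitone (Fin.zero_le s)
  have hki : (1 : ℝ) ≤ |(k s i : ℝ)| := by
    have h1 : (k s i) ≠ 0 := hsi
    exact_mod_cast Int.one_le_abs h1
  have hsum : |∑ s' ∈ Finset.univ.erase s, (δ s')⁻¹ * k s' i| ≤ 1 / 2 * (δ s)⁻¹ := by
    calc |∑ s' ∈ Finset.univ.erase s, (δ s')⁻¹ * k s' i|
        ≤ ∑ s' ∈ Finset.univ.erase s, |(δ s')⁻¹ * k s' i| := Finset.abs_sum_le_sum_abs _ _
      _ ≤ ∑ _s' ∈ Finset.univ.erase s, 1 / (2 * (m + 1 : ℝ)) * (δ s)⁻¹ :=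
          Finset.sum_le_sum fun s' hs' => hother s' (Finset.ne_of_mem_erase hs')
      _ = m * (1 / (2 * (m + 1 : ℝ)) * (δ s)⁻¹) := by simp
      _ ≤ (m + 1) * (1 / (2 * (m + 1 : ℝ)) * (δ s)⁻¹) := by
          refine mul_le_mul_of_nonneg_right (by linarith) ?_
          have := (inv_pos.mpr (hδ0 s)).le
          positivity
      _ = _ := by field_simp
  -- The at most `m` coarser scales cancel no more than half of the leading term; the factor `2π`
  -- then brings the symbol above `1`.
  have hmain : 1 / 2 ≤ |∑ s', (δ s')⁻¹ * (k s' i : ℝ)| := by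
    rw [← Finset.add_sum_erase _ _ (Finset.mem_univ s)]
    have h1 : (δ s)⁻¹ ≤ |(δ s)⁻¹ * (k s i : ℝ)| := by
      rw [abs_mul, abs_of_pos (inv_pos.mpr (hδ0 s))]
      exact le_mul_of_one_le_right (inv_pos.mpr (hδ0 s)).le hki
    have h2 := abs_sub_abs_le_abs_sub ((δ s)⁻¹ * (k s i : ℝ))
      (-∑ s' ∈ Finset.univ.erase s, (δ s')⁻¹ * (k s' i : ℝ))
    rw [abs_neg, sub_neg_eq_add] at h2
    linarith
  have hsymb : 1 ≤ |symb δ k i| := by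
    rw [symb, abs_mul, abs_of_pos Real.two_pi_pos]
    nlinarith [Real.pi_gt_three]
  calc (1 : ℝ) ≤ symb δ k i ^ 2 := (one_le_sq_iff_one_le_abs _).mpr hsymb
    _ ≤ _ := Finset.single_le_sum (f := fun i => symb δ k i ^ 2) (fun _ _ => sq_nonneg _)
        (Finset.mem_univ i)

end Resonance

/-! ### The defect of the flux corrector -/

section Defect

variable {d n : ℕ} {δ : Fin n → ℝ} {τ : ℝ} {A : Vars d n → Matrix (Fin d) (Fin d) ℝ}
  {X : Fin d → Vars d n → ℝ} {U : Fin d → Fin d → Vars d n → ℝ}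

/-- Chain rule along the linear embedding `y ↦ (y/δ_1, …, y/δ_n)`. -/
theorem pd_atScales (δ : Fin n → ℝ) {f : Vars d n → ℝ} (hf : Differentiable ℝ f) (i : Fin d)
    (y : Fin d → ℝ) : pd i (atScales δ f) y = atScales δ (hatD δ i f) y := by
  let L : (Fin d → ℝ) →L[ℝ] Vars d n := ContinuousLinearMap.pi fun s =>
    ContinuousLinearMap.pi fun i => (δ s)⁻¹ • ContinuousLinearMap.proj i
  have hL : ∀ y, L y = fun s i => y i / δ s := fun y => by
    ext s i; simp [L, div_eq_inv_mul]
  have h1 : atScales δ f = f ∘ L := by ext y; simp [atScales, hL]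
  have h2 : L (Pi.single i 1) = ∑ s, (δ s)⁻¹ • dir s i := by
    rw [hL]
    ext s i'
    rw [Finset.sum_apply, Finset.sum_apply, Finset.sum_eq_single s]
    · simp [dir, Pi.single_apply, div_eq_inv_mul]
    · intro b _ hb; simp [dir, hb.symm]
    · simp
  rw [pd, h1, fderiv_comp y (hf _) L.differentiableAt, L.fderiv, ContinuousLinearMap.comp_apply,
    h2, map_sum]
  simp [atScales, hatD, hL]

/-- The defect of the flux corrector on the torus. -/
noncomputable def torusDefect (δ : Fin n → ℝ) (A : Vars d n → Matrix (Fin d) (Fin d) ℝ)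
    (X : Fin d → Vars d n → ℝ) (U : Fin d → Fin d → Vars d n → ℝ) (i j : Fin d)
    (y : Vars d n) : ℝ :=
  flux δ A X y i j - effective δ A X i j - ∑ l, hatD δ l (fluxCorrector δ U l i j) y

theorem isSmoothPeriodic_fluxCorrector (hU : ∀ i j, IsSmoothPeriodic (U i j)) (l i j : Fin d) :
    IsSmoothPeriodic (fluxCorrector δ U l i j) :=
  ((hU i j).hatD δ l).sub ((hU l j).hatD δ i)

theorem isSmoothPeriodic_flux (hA : ∀ i j, IsSmoothPeriodic fun y => A y i j)
    (hX : ∀ j, IsSmoothPeriodic (X j)) (i j : Fin d) :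
    IsSmoothPeriodic fun y => flux δ A X y i j :=
  (hA i j).add (IsSmoothPeriodic.sum Finset.univ fun k => (hA i k).mul ((hX j).hatD δ k))

/-- The defect on `ℝ^d` is a restriction of a function on the torus, so a supremum bound there
suffices. -/
theorem fluxDefect_eq (hX : ∀ j, IsSmoothPeriodic (X j)) (hU : ∀ i j, IsSmoothPeriodic (U i j))
    (i j : Fin d) (y : Fin d → ℝ) :
    fluxDefect δ A X U i j y = atScales δ (torusDefect δ A X U i j) y := by
  rw [fluxDefect]
  simp_rw [pd_atScales δ (hX j).differentiable,
    pd_atScales δ (isSmoothPeriodic_fluxCorrector hU _ i j).differentiable]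
  rfl

theorem isSmoothPeriodic_torusDefect (hA : ∀ i j, IsSmoothPeriodic fun y => A y i j)
    (hX : ∀ j, IsSmoothPeriodic (X j)) (hU : ∀ i j, IsSmoothPeriodic (U i j)) (i j : Fin d) :
    IsSmoothPeriodic (torusDefect δ A X U i j) :=
  ((isSmoothPeriodic_flux hA hX i j).sub (IsSmoothPeriodic.const _)).sub
    (IsSmoothPeriodic.sum Finset.univ fun l => (isSmoothPeriodic_fluxCorrector hU l i j).hatD δ l)

/-- With `h = Ā - flux`, `∇̂·Φ_{ij} = Δ̂U_{ij} - ∂̂_i ∑_l ∂̂_l U_{lj}` and the equation for `U`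
reduce the defect to `-τ²U_{ij} + ∂̂_i ∑_l ∂̂_l U_{lj}`. Now `-Δ̂ + τ²` maps `U_{ij}` to `h_{ij}`,
and `∑_l ∂̂_l U_{lj}` to the divergence of the `j`-th column of `h`, which is `-τ²X_j` by the
corrector equation. -/
theorem coef_torusDefect (hA : ∀ i j, IsSmoothPeriodic fun y => A y i j)
    (hX : ∀ j, IsCorrector δ τ A (Pi.single j 1) (X j))
    (hU : ∀ i j, IsFluxPotential δ τ A X i j (U i j)) (i j : Fin d) (k : Modes d n) :
    ((∑ i, symb δ k i ^ 2 + τ ^ 2 : ℝ) : ℂ) * coef (torusDefect δ A X U i j) k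
      = -(τ : ℂ) ^ 2 * (coef (fun y => effective δ A X i j - flux δ A X y i j) k
        + symb δ k i * (Complex.I * coef (X j) k)) := by
  have hXs := fun j => (hX j).isSmoothPeriodic
  have hUs := fun i j => (hU i j).isSmoothPeriodic
  have hfl := isSmoothPeriodic_flux (δ := δ) hA hXs
  have hc : ∀ i j, IsSmoothPeriodic fun _ : Vars d n => effective δ A X i j :=
    fun i j => IsSmoothPeriodic.const _
  set h : Fin d → Fin d → ℂ :=
    fun i j => coef (fun y => effective δ A X i j - flux δ A X y i j) k with hh
  set u : Fin d → Fin d → ℂ := fun i j => coef (U i j) k with hu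
  set q : ℂ := ((∑ i, symb δ k i ^ 2 + τ ^ 2 : ℝ) : ℂ) with hq
  have hpot : ∀ i j, q * u i j = h i j := fun i j =>
    coef_potential (hUs i j) (hU i j).equation k
  -- the divergence of the corrector equation
  have hdiv : ∑ l, (symb δ k l : ℂ) * h l j = Complex.I * (τ : ℂ) ^ 2 * coef (X j) k := by
    have hF := IsSmoothPeriodic.mulVec hA (F := hatGrad δ (X j)) fun i => (hXs j).hatD δ i
    have hv := IsSmoothPeriodic.mulVec hA (F := fun _ => Pi.single j 1)
      fun i => IsSmoothPeriodic.const _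
    have hL := IsSmoothPeriodic.hatDiv δ hF
    have hR := IsSmoothPeriodic.hatDiv δ hv
    have h1 : ∀ y, hatDiv δ (fun y' => A y' *ᵥ Pi.single j 1) y
        - (-hatDiv δ (fun y' => A y' *ᵥ hatGrad δ (X j) y') y) = τ ^ 2 * X j y := fun y => by
      rw [← (hX j).equation y]; ring
    have h2 := congrArg (fun f => coef f k) (funext h1)
    beta_reduce at h2
    rw [coef_sub hR.continuous hL.neg.continuous, coef_neg_fun, coef_const_mul, sub_neg_eq_add,
      coef_hatDiv δ hv, coef_hatDiv δ hF, ← Finset.sum_add_distrib] at h2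
    have h3 : ∀ l, (symb δ k l : ℂ) * h l j = Complex.I * (Complex.I * symb δ k l
          * coef (fun y => (A y *ᵥ Pi.single j 1) l) k
        + Complex.I * symb δ k l * coef (fun y => (A y *ᵥ hatGrad δ (X j) y) l) k) := by
      intro l
      have h4 : coef (fun y => flux δ A X y l j) k = coef (fun y => (A y *ᵥ Pi.single j 1) l) k
          + coef (fun y => (A y *ᵥ hatGrad δ (X j) y) l) k := by
        rw [← coef_add (hv l).continuous (hF l).continuous]
        congr 1
        ext y
        rw [Matrix.mulVec_single_one]
        rfl
      have h5 : (symb δ k l : ℂ) * coef (fun _ : Vars d n => effective δ A X l j) k = 0 := by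
        rw [coef_const]
        split_ifs with hk
        · rw [hk, symb_zero]; simp
        · simp
      rw [hh]
      beta_reduce
      rw [coef_sub (hc l j).continuous (hfl l j).continuous, mul_sub, h5, h4]
      linear_combination (-(symb δ k l : ℂ) * (coef (fun y => (A y *ᵥ Pi.single j 1) l) k
          + coef (fun y => (A y *ᵥ hatGrad δ (X j) y) l) k)) * Complex.I_mul_I
    simp_rw [h3]
    rw [← Finset.mul_sum, h2]
    push_cast
    ring
  have hpu : q * ∑ l, (symb δ k l : ℂ) * u l j = Complex.I * (τ : ℂ) ^ 2 * coef (X j) k := by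
    rw [← hdiv, Finset.mul_sum]
    refine Finset.sum_congr rfl fun l _ => ?_
    rw [← hpot]
    ring
  have hD : coef (torusDefect δ A X U i j) k = -h i j + ∑ l, (symb δ k l : ℂ) ^ 2 * u i j
      - symb δ k i * ∑ l, (symb δ k l : ℂ) * u l j := by
    have hΦ := fun l => isSmoothPeriodic_fluxCorrector (δ := δ) hUs l i j
    have hfe : IsSmoothPeriodic fun y => flux δ A X y i j - effective δ A X i j :=
      (hfl i j).sub (hc i j)
    have hs : IsSmoothPeriodic fun y => ∑ l, hatD δ l (fluxCorrector δ U l i j) y :=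
      IsSmoothPeriodic.sum Finset.univ fun l => (hΦ l).hatD δ l
    have h1 : coef (torusDefect δ A X U i j) k
        = coef (fun y => flux δ A X y i j - effective δ A X i j) k
          - ∑ l, coef (hatD δ l (fluxCorrector δ U l i j)) k := by
      rw [← coef_sum Finset.univ fun l => ((hΦ l).hatD δ l).continuous]
      exact coef_sub hfe.continuous hs.continuous k
    have h2 : coef (fun y => flux δ A X y i j - effective δ A X i j) k = -h i j := by
      rw [hh]
      beta_reduce
      rw [← coef_neg_fun]
      congr 1
      ext y
      ring
    have h3 : ∀ l, coef (hatD δ l (fluxCorrector δ U l i j)) k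
        = Complex.I * symb δ k l * (Complex.I * symb δ k l * u i j
          - Complex.I * symb δ k i * u l j) := by
      intro l
      rw [coef_hatD δ (hΦ l)]
      congr 1
      change coef (fun y => hatD δ l (U i j) y - hatD δ i (U l j) y) k = _
      rw [coef_sub ((hUs i j).hatD δ l).continuous ((hUs l j).hatD δ i).continuous,
        coef_hatD δ (hUs i j), coef_hatD δ (hUs l j)]
    rw [h1, h2]
    simp_rw [h3]
    rw [Finset.mul_sum, add_sub_assoc, ← Finset.sum_sub_distrib, sub_eq_add_neg,
      ← Finset.sum_neg_distrib]
    congr 1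
    refine Finset.sum_congr rfl fun l _ => ?_
    linear_combination (-((symb δ k l : ℂ) ^ 2 * u i j - symb δ k l * symb δ k i * u l j))
      * Complex.I_mul_I
  have hqs : ∑ l, (symb δ k l : ℂ) ^ 2 * u i j = (q - (τ : ℂ) ^ 2) * u i j := by
    rw [hq, ← Finset.sum_mul]
    push_cast
    ring
  rw [hD, hqs]
  linear_combination (q - (τ : ℂ) ^ 2) * hpot i j - (symb δ k i : ℂ) * hpu

end Defect

/-! ### The pointwise estimate -/

section Main

variable {d m : ℕ}

theorem abs_le_of_coef_decay {n : ℕ} {f : Vars d n → ℝ} (hf : IsSmoothPeriodic f) {M σ : ℝ}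
    (hσ : 0 < σ) (hM : ∀ k, ‖coef f k‖ ≤ M * Real.exp (-(σ * size k))) (y : Vars d n) :
    |f y| ≤ M * ∑' k : Modes d n, Real.exp (-(σ * size k)) := by
  have h1 := hasSum_coef hf.continuous hf.periodic (summable_norm_of_decay hσ hM).of_norm y
  have h2 := h1.norm_le_of_bounded ((summable_exp_size hσ).hasSum.mul_left M)
    fun k => by rw [norm_mul, norm_wave, mul_one]; exact hM k
  simpa using h2

/-- The pointwise bound for the defect on the torus. -/
theorem abs_torusDefect_le (hm : 1 ≤ m) {σ M K κ τ : ℝ} (hσ : 0 < σ) (hM : 0 ≤ M) (hK : 1 ≤ K)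
    (hκ : κ = σ / 2 * (1 / (2 * (m + 1 : ℝ)))) {ε δ : Fin (m + 1) → ℝ} (hε : ∀ k, 0 < ε k)
    (hanti : StrictAnti ε) (hδ : ∀ k, δ k = ε k / ε 0) (hτ : 0 < τ)
    (h1 : K⁻¹ * resonance κ ε ≤ τ ^ 2) (h2 : τ ^ 2 ≤ K * resonance κ ε)
    {A : Vars d (m + 1) → Matrix (Fin d) (Fin d) ℝ} {X : Fin d → Vars d (m + 1) → ℝ}
    {U : Fin d → Fin d → Vars d (m + 1) → ℝ} (hA : ∀ i j, IsSmoothPeriodic fun y => A y i j)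
    (hX : ∀ j, IsCorrector δ τ A (Pi.single j 1) (X j))
    (hU : ∀ i j, IsFluxPotential δ τ A X i j (U i j))
    (hpX : ∀ j k i, |symb δ k i| * ‖coef (X j) k‖ ≤ M * Real.exp (-(σ * size k)))
    (hflux : ∀ i j k, ‖coef (fun y => flux δ A X y i j) k‖ ≤ M * Real.exp (-(σ * size k)))
    (i j : Fin d) (y : Vars d (m + 1)) :
    |torusDefect δ A X U i j y|
      ≤ 2 * M * K ^ 2 * (∑' k : Modes d (m + 1), Real.exp (-(σ / 2 * size k))) * τ := by
  have hXs := fun j => (hX j).isSmoothPeriodic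
  have hUs := fun i j => (hU i j).isSmoothPeriodic
  have hτ2 : 0 < τ ^ 2 := by positivity
  have hκ0 : 0 < κ := by rw [hκ]; positivity
  have hK0 : 0 < K := by linarith
  have hres : resonance κ ε ≤ K * τ ^ 2 := by
    rwa [inv_mul_le_iff₀ hK0] at h1
  -- `τ² ≤ K · resonance ≤ K ≤ K²`.
  have hτK : τ ≤ K := by
    have h3 := resonance_le_one hm hκ0 hε
    nlinarith
  -- Half of the decay rate is kept for summing over `k`; the other half pays for the resonant
  -- modes.
  have hdec : ∀ k, ‖coef (torusDefect δ A X U i j) k‖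
      ≤ 2 * M * K * τ ^ 2 * Real.exp (-(σ / 2 * size k)) := by
    intro k
    have hid := congrArg norm (coef_torusDefect hA hX hU i j k)
    set D := ‖coef (torusDefect δ A X U i j) k‖ with hD
    have hs0 : 0 ≤ ∑ i, symb δ k i ^ 2 := Finset.sum_nonneg fun _ _ => sq_nonneg _
    have hD0 : 0 ≤ D := norm_nonneg _
    rw [norm_mul, Complex.norm_real, Real.norm_eq_abs, abs_of_nonneg (by positivity), ← hD,
      norm_mul, norm_neg, norm_pow, Complex.norm_real, Real.norm_eq_abs, abs_of_pos hτ] at hid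
    rcases eq_or_ne k 0 with rfl | hk
    -- The zero mode drops out because `Ā` is the mean of the flux.
    · have h3 : coef (fun y => effective δ A X i j - flux δ A X y i j) 0 = 0 := by
        rw [coef_sub continuous_const (isSmoothPeriodic_flux hA hXs i j).continuous, coef_const,
          coef_zero_index, if_pos rfl]
        simp [effective]
      rw [h3] at hid
      simp only [symb_zero, Complex.ofReal_zero, zero_mul, add_zero, norm_zero, mul_zero] at hid
      have h4 : D ≤ 0 := by
        rcases mul_eq_zero.mp hid with h | h
        · simp at h; exact absurd h hτ.ne'
        · exact h.le
      exact h4.trans (by positivity)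
    · have h3 : ‖coef (fun y => effective δ A X i j - flux δ A X y i j) k
          + symb δ k i * (Complex.I * coef (X j) k)‖ ≤ 2 * M * Real.exp (-(σ * size k)) := by
        rw [coef_sub continuous_const (isSmoothPeriodic_flux hA hXs i j).continuous, coef_const,
          if_neg hk, zero_sub]
        refine (norm_add_le _ _).trans ?_
        rw [norm_neg, norm_mul, norm_mul, Complex.norm_I, one_mul, Complex.norm_real,
          Real.norm_eq_abs]
        linarith [hpX j k i, hflux i j k]
      have h4 : (∑ i, symb δ k i ^ 2 + τ ^ 2) * D
          ≤ τ ^ 2 * (2 * M * Real.exp (-(σ * size k))) := by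
        rw [hid]
        exact mul_le_mul_of_nonneg_left h3 hτ2.le
      have hexp : Real.exp (-(σ * size k))
          = Real.exp (-(σ / 2 * size k)) * Real.exp (-(σ / 2 * size k)) := by
        rw [← Real.exp_add]; congr 1; ring
      have hexp1 : Real.exp (-(σ / 2 * size k)) ≤ 1 :=
        Real.exp_le_one_iff.mpr (neg_nonpos.mpr (mul_nonneg (half_pos hσ).le (size_nonneg k)))
      have hE0 := (Real.exp_pos (-(σ / 2 * size k))).le
      rw [hexp] at h4
      set E := Real.exp (-(σ / 2 * size k)) with hE
      rcases one_le_symb_or hε hanti hδ hk with h5 | ⟨s, h5⟩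
      · calc D ≤ (∑ i, symb δ k i ^ 2 + τ ^ 2) * D := le_mul_of_one_le_left hD0 (by linarith)
          _ ≤ τ ^ 2 * (2 * M * (E * E)) := h4
          _ ≤ τ ^ 2 * (2 * M * (K * E)) := by
              gcongr
              linarith
          _ = _ := by ring
      -- Resonant mode: the divisor is only known to be at least `τ²`. By the choice of `κ`, half of
      -- the exponential is at most the resonance, which restores the factor `τ²`.
      · have h6 : E ≤ K * τ ^ 2 := by
          refine le_trans ?_ ((exp_le_resonance κ ε s).trans hres)
          refine Real.exp_le_exp.mpr (neg_le_neg ?_)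
          rw [hκ, mul_assoc]
          exact mul_le_mul_of_nonneg_left h5 (half_pos hσ).le
        have h7 : τ ^ 2 * D ≤ τ ^ 2 * (2 * M * (E * E)) :=
          le_trans (mul_le_mul_of_nonneg_right (by linarith) hD0) h4
        calc D ≤ 2 * M * (E * E) := le_of_mul_le_mul_left h7 hτ2
          _ ≤ 2 * M * (K * τ ^ 2 * E) := by gcongr
          _ = _ := by ring
  have hT0 : 0 ≤ ∑' k : Modes d (m + 1), Real.exp (-(σ / 2 * size k)) :=
    tsum_nonneg fun _ => (Real.exp_pos _).le
  refine (abs_le_of_coef_decay (isSmoothPeriodic_torusDefect hA hXs hUs i j) (half_pos hσ)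
    hdec y).trans ?_
  set T := ∑' k : Modes d (m + 1), Real.exp (-(σ / 2 * size k))
  calc 2 * M * K * τ ^ 2 * T = 2 * M * K * T * τ * τ := by ring
    _ ≤ 2 * M * K * T * τ * K := mul_le_mul_of_nonneg_left hτK (by positivity)
    _ = _ := by ring

end Main

end Multiscale

/-! ### Assembly of the theorem -/

theorem corollary4p8 (d m : ℕ) (hd : 1 ≤ d) (hm : 1 ≤ m)
    (lam C₀ Λ₀ : ℝ) (hlam : 0 < lam) (hC₀ : 0 < C₀) (hΛ₀ : 0 < Λ₀) :
    ∃ (c : Fin m → ℝ) (κ : ℝ), (∀ j, 0 < c j) ∧ 0 < κ ∧ ∀ K : ℝ, 1 ≤ K → ∃ C : ℝ, 0 < C ∧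
      ∀ (N : ℕ) (L₀ : ℝ)
        (A : (Fin N → ℝ) → Multiscale.Vars d (m + 1) → Matrix (Fin d) (Fin d) ℝ)
        (ε δ : Fin (m + 1) → ℝ) (τ : ℝ),
        Multiscale.IsCoefficient lam C₀ Λ₀ L₀ A →
        (∀ k, 0 < ε k) → StrictAnti ε → ε 0 ≤ 1 →
        Multiscale.ScaleSeparated c ε →
        (∀ k, δ k = ε k / ε 0) →
        0 < τ →
        K⁻¹ * Multiscale.resonance κ ε ≤ τ ^ 2 →
        τ ^ 2 ≤ K * Multiscale.resonance κ ε →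
        -- the correctors and the flux potentials exist and are unique
        (∀ x j, ∃! X, Multiscale.IsCorrector δ τ (A x) (Pi.single j 1) X) ∧
        (∀ x X, (∀ j, Multiscale.IsCorrector δ τ (A x) (Pi.single j 1) (X j)) →
          ∀ i j, ∃! U, Multiscale.IsFluxPotential δ τ (A x) X i j U) ∧
        -- the flux corrector built from them is antisymmetric and satisfies the estimate
        ∀ (X : (Fin N → ℝ) → Fin d → Multiscale.Vars d (m + 1) → ℝ)
          (U : (Fin N → ℝ) → Fin d → Fin d → Multiscale.Vars d (m + 1) → ℝ),
          (∀ x j, Multiscale.IsCorrector δ τ (A x) (Pi.single j 1) (X x j)) →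
          (∀ x i j, Multiscale.IsFluxPotential δ τ (A x) (X x) i j (U x i j)) →
          (∀ x l i j y, Multiscale.fluxCorrector δ (U x) l i j y
            = -Multiscale.fluxCorrector δ (U x) i l j y) ∧
          (⨆ x, ∑ i, ∑ j,
              eLpNorm (Multiscale.fluxDefect δ (A x) (X x) (U x) i j) ∞ volume)
            ≤ ENNReal.ofReal (C * τ) := by
  have : Nonempty (Fin d) := ⟨⟨0, hd⟩⟩
  obtain ⟨σ, M, hσ, hM, hcorr⟩ := Multiscale.exists_corrector (d := d) (n := m + 1) hlam hC₀ hΛ₀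
  -- Half of the decay rate times the resonance threshold in `one_le_symb_or`.
  set κ : ℝ := σ / 2 * (1 / (2 * (m + 1 : ℝ))) with hκ
  refine ⟨fun _ => 1, κ, fun _ => one_pos, by positivity, fun K hK => ?_⟩
  set T := ∑' k : Multiscale.Modes d (m + 1), Real.exp (-(σ / 2 * Multiscale.size k)) with hT
  have hT0 : 0 ≤ T := tsum_nonneg fun _ => (Real.exp_pos _).le
  set B : ℝ := 2 * M * K ^ 2 * T with hB
  have hB0 : 0 ≤ B := by positivity
  -- One `B` for each of the `d * d` entries; the `1` ensures positivity, since `B` may vanish.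
  refine ⟨d * d * B + 1, by positivity, ?_⟩
  intro N L₀ A ε δ τ hA hε hanti _ _ hδ hτ h1 h2
  have hAs : ∀ x i j, Multiscale.IsSmoothPeriodic fun y => A x y i j := fun x i j =>
    ⟨hA.smooth x i j, fun y z => by rw [hA.periodic x y z]⟩
  have hpos : ∀ x y (ξ : Fin d → ℝ), 0 ≤ ξ ⬝ᵥ (A x y *ᵥ ξ) := fun x y ξ =>
    le_trans (mul_nonneg hlam.le (Finset.sum_nonneg fun i _ => mul_self_nonneg _))
      (hA.elliptic x y ξ)
  have han : ∀ x i j y (ℓ : ℕ), Multiscale.absDeriv ℓ (fun y' => A x y' i j) y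
      ≤ C₀ * Λ₀ ^ ℓ * (ℓ ! : ℝ) := by
    intro x i j y ℓ
    have h0 : ∀ i j, 0 ≤ Multiscale.absDeriv ℓ (fun y' => A x y' i j) y := fun i j =>
      Finset.sum_nonneg fun J _ => abs_nonneg _
    refine le_trans ?_ (hA.analytic x y ℓ)
    exact (Finset.single_le_sum (f := fun j => Multiscale.absDeriv ℓ (fun y' => A x y' i j) y)
        (fun j _ => h0 i j) (Finset.mem_univ j)).trans
      (Finset.single_le_sum
        (f := fun i => ∑ j, Multiscale.absDeriv ℓ (fun y' => A x y' i j) y)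
        (fun i _ => Finset.sum_nonneg fun j _ => h0 i j) (Finset.mem_univ i))
  have hcor := fun x => hcorr (A x) δ τ hτ (hAs x) (hA.elliptic x) (han x)
  -- The decay estimates come with the constructed correctors; uniqueness transfers them to any
  -- given ones.
  have huniq : ∀ x X, (∀ j, Multiscale.IsCorrector δ τ (A x) (Pi.single j 1) (X j)) →
      X = Classical.choose (hcor x) := fun x X hX => funext fun j =>
    (hX j).unique hτ (hAs x) (hpos x) (Classical.choose_spec (hcor x) j).1
  refine ⟨fun x j => ?_, fun x X hX i j => ?_, fun X U hX hU => ⟨fun x l i j y => ?_, ?_⟩⟩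
  · refine ⟨_, (Classical.choose_spec (hcor x) j).1, fun X' hX' => ?_⟩
    exact hX'.unique hτ (hAs x) (hpos x) (Classical.choose_spec (hcor x) j).1
  · have hfl : Multiscale.IsSmoothPeriodic fun y => Multiscale.flux δ (A x) X y i j :=
      Multiscale.isSmoothPeriodic_flux (hAs x) (fun j => (hX j).isSmoothPeriodic) i j
    have hc : Multiscale.IsSmoothPeriodic fun _ : Multiscale.Vars d (m + 1) =>
        Multiscale.effective δ (A x) X i j := Multiscale.IsSmoothPeriodic.const _
    have hdec : ∀ k, ‖Multiscale.coef (fun y => Multiscale.effective δ (A x) X i j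
        - Multiscale.flux δ (A x) X y i j) k‖
        ≤ M * Real.exp (-(σ * Multiscale.size k)) := by
      intro k
      rw [Multiscale.coef_sub hc.continuous hfl.continuous, Multiscale.coef_const]
      split_ifs with hk
      -- Subtracting the flux from its mean cancels the zero mode and changes only the sign of the
      -- others, so the decay of the flux is inherited.
      · rw [hk, Multiscale.coef_zero_index]
        simp only [Multiscale.effective, sub_self, norm_zero]
        positivity
      · rw [zero_sub, norm_neg]
        have := (Classical.choose_spec (hcor x) j).2.2 i k
        rwa [← huniq x X hX] at this
    obtain ⟨U, hUs, hUe⟩ := Multiscale.exists_potential (δ := δ) hτ (hc.sub hfl) hσ hdec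
    have hU : Multiscale.IsFluxPotential δ τ (A x) X i j U := ⟨hUs.smooth, hUs.periodic, hUe⟩
    exact ⟨U, hU, fun U' hU' => hU'.unique hτ hU⟩
  · simp [Multiscale.fluxCorrector]
  · refine iSup_le fun x => ?_
    have hspec := Classical.choose_spec (hcor x)
    rw [← huniq x (X x) (hX x)] at hspec
    have hentry : ∀ i j, eLpNorm (Multiscale.fluxDefect δ (A x) (X x) (U x) i j) ∞ volume
        ≤ ENNReal.ofReal (B * τ) := by
      intro i j
      rw [eLpNorm_exponent_top]
      refine eLpNormEssSup_le_of_ae_bound (Filter.Eventually.of_forall fun y => ?_)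
      rw [Multiscale.fluxDefect_eq (fun j => (hX x j).isSmoothPeriodic)
        (fun i j => (hU x i j).isSmoothPeriodic), Real.norm_eq_abs]
      exact Multiscale.abs_torusDefect_le hm hσ hM hK hκ hε hanti hδ hτ h1 h2 (hAs x) (hX x)
        (hU x) (fun j => (hspec j).2.1) (fun i j => (hspec j).2.2 i) i j _
    calc ∑ i, ∑ j, eLpNorm (Multiscale.fluxDefect δ (A x) (X x) (U x) i j) ∞ volume
        ≤ ∑ _i : Fin d, ∑ _j : Fin d, ENNReal.ofReal (B * τ) :=
          Finset.sum_le_sum fun i _ => Finset.sum_le_sum fun j _ => hentry i j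
      _ = ENNReal.ofReal (d * d * (B * τ)) := by
          simp only [Finset.sum_const, Finset.card_univ, Fintype.card_fin, nsmul_eq_mul]
          rw [mul_assoc (d : ℝ), ENNReal.ofReal_mul (Nat.cast_nonneg d),
            ENNReal.ofReal_mul (Nat.cast_nonneg d), ENNReal.ofReal_natCast]
      _ ≤ _ := ENNReal.ofReal_le_ofReal (by nlinarith)
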